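/- **Setting.** Let $\mathcal H$ be an infinite-dimensional separable real or complex Hilbert space, with scalar field $\mathbb K$. Let $(\Omega,\mathcal F,\mathbb P)$ be a non-atomic probability space (for instance a non-atomic Lebesgue space): every measurable set of positive measure has a measurable subset of strictly smaller positive measure. Let $\theta:\Omega\to\Omega$ be an invertible, bimeasurable, measure-preserving ergodic transformation. Let $\mathcal K_\infty$ be the space of maps $T$ from $\Omega$ to the compact operators on $\mathcal H$ such that $\omega\mapsto T(\omega)x$ is measurable for every $x\in\mathcal H$ and $\|T\|_\infty:=\operatorname{ess\,sup}_\omega\|T(\omega)\|<\infty$. Put $T^0_\omega=\mathrm{id}$ and $T^n_\omega=T(\theta^{n-1}\omega)\cdots T(\omega)$ for $n\ge 1$. Let $\mathcal N$ be the set of $T\in\mathcal K_\infty$ such that $\lim_{n\to\infty}\big((T^n_\omega)^*T^n_\omega\big)^{1/(2n)}=0$ in operator norm for almost every $\omega$. A *random unit vector* is a measurable map $e:\Omega\to\mathcal H$ with $\|e(\omega)\|=1$ for all $\omega$; it is *invariant* under $S$ if $S(\omega)e(\omega)$ is collinear to $e(\theta\omega)$ for all $\omega\in\Omega$. For $T\in\mathcal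 K_\infty$, $\eta>0$ and an integer $N\ge1$, call a measurable set $V$ with $\mathbb P(V)>0$ an *$(\eta,N)$-connecting set for $T$* if $V,\theta V,\dots,\theta^NV$ are pairwise disjoint and, with $W=\bigcup_{i=0}^{N-1}\theta^iV$, for every measurable $e:V\cup\theta^NV\to\mathcal H$ of unit vectors there are $S\in\mathcal K_\infty$, a measurable $\beta:W\to\mathbb K$ with $|\beta|\ge\eta/3$ on $W$, and an extension of $e$ to a measurable map of unit vectors on $\bigcup_{i=0}^N\theta^iV$, such that $S=T$ off $W$, $\|S(\omega)-T(\omega)\|\le\eta$ for $\omega\in W$, and $S(\theta^i\omega)e(\theta^i\omega)=\beta(\theta^i\omega)e(\theta^{i+1}\omega)$ for $\omega\in V$, $0\le i\le N-1$. **Proposition.** Let $T\in\mathcal N$ and $\varepsilon\in(0,\tfrac16)$. For integers $N\ge1$ and $k\ge0$ consider the following assertion. $(\ast)_{N,k}$ There exist $S\in\mathcal K_\infty$ and an $S$-invariant random unit vector $e:\Omega\to\mathcal H$ such that $\|S-T\|_\infty\le3\varepsilon(1+\|T\|_\infty)$ and, for all $\omega\in\Omega$, $$\|S(\omega)e(\omega)\|\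 \ge\ \frac{\varepsilon^{N+1}}{(1+2\|T\|_\infty)^{N-1}},\qquad \|S^{kN}_\omega e(\omega)\|\ \ge\ \frac{\varepsilon^{k+4N}}{(1+2\|T\|_\infty)^{4N}}\,\|S^{kN}_\omega\|.$$ 1. If $N\ge1$ and there is an $(\eta,N)$-connecting set for $T$ for some $\eta\in(0,3\varepsilon]$, then $(\ast)_{N,k}$ holds for every $k\ge 0$. 2. There is an integer $N^*=N^*(T,\varepsilon)\ge1$ such that $(\ast)_{N,k}$ holds for all $N\ge N^*$ and all $k\ge 0$. -/

import Mathlib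

open MeasureTheory Filter Topology
open scoped ENNReal

namespace RandomCompact

variable {𝕜 H Ω : Type*} [RCLike 𝕜] [NormedAddCommGroup H] [InnerProductSpace 𝕜 H]
  [MeasurableSpace H] [MeasurableSpace Ω]

/-- The measure `μ` has no atoms: every measurable set of positive measure has a measurable
subset of strictly smaller positive measure. -/
def NonAtomic (μ : Measure Ω) : Prop :=
  ∀ A : Set Ω, MeasurableSet A → 0 < μ A →
    ∃ B : Set Ω, B ⊆ A ∧ MeasurableSet B ∧ 0 < μ B ∧ μ B < μ A

/-- The class `𝒦_∞(Ω; H)`: strongly measurable, essentially bounded maps from `Ω` to the compact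
operators on `H`. -/
structure IsBddRandomCompact (μ : Measure Ω) (T : Ω → H →L[𝕜] H) : Prop where
  compact : ∀ ω, IsCompactOperator (T ω)
  stronglyMeasurable : ∀ x : H, Measurable fun ω => T ω x
  essBdd : eLpNormEssSup T μ < ∞

/-- The norm `‖T‖_∞`, the essential supremum of the operator norm of `T(ω)`. -/
noncomputable def supNorm (μ : Measure Ω) (T : Ω → H →L[𝕜] H) : ℝ :=
  (eLpNormEssSup T μ).toReal

/-- The cocycle `T^n_ω = T(θ^{n-1} ω) ⋯ T(θ ω) T(ω)`, with `T^0_ω = id`. -/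
def cocycle (θ : Ω → Ω) (T : Ω → H →L[𝕜] H) : ℕ → Ω → H →L[𝕜] H
  | 0, _ => ContinuousLinearMap.id 𝕜 H
  | n + 1, ω => (T (θ^[n] ω)).comp (cocycle θ T n ω)

/-- `L` is the operator-norm limit of `((T^n_ω)^* T^n_ω)^{1/(2n)}`; the root is the (unique)
positive operator whose `2n`-th power is `(T^n_ω)^* T^n_ω`. -/
def IsOseledetsLimit [CompleteSpace H] (θ : Ω → Ω) (T : Ω → H →L[𝕜] H) (ω : Ω)
    (L : H →L[𝕜] H) : Prop :=
  ∃ A : ℕ → H →L[𝕜] H,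
    (∀ n, 1 ≤ n → (A n).IsPositive ∧
      A n ^ (2 * n) = (ContinuousLinearMap.adjoint (cocycle θ T n ω)).comp (cocycle θ T n ω)) ∧
    Tendsto A atTop (𝓝 L)

/-- The class `𝒩` of bounded random compact operators converging to the null operator:
`Λ_ω(T) = 0` for almost every `ω`. -/
structure IsNull [CompleteSpace H] (μ : Measure Ω) (θ : Ω → Ω) (T : Ω → H →L[𝕜] H) : Prop where
  mem : IsBddRandomCompact μ T
  limit_eq_zero : ∀ᵐ ω ∂μ, IsOseledetsLimit θ T ω 0

/-- A random unit vector of `H`. -/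
structure IsRandomUnit (e : Ω → H) : Prop where
  measurable : Measurable e
  norm_eq_one : ∀ ω, ‖e ω‖ = 1

/-- `e` is invariant under `S`: `S(ω) e(ω)` is collinear to `e(θ ω)`. -/
def IsInvariantDirection (θ : Ω → Ω) (S : Ω → H →L[𝕜] H) (e : Ω → H) : Prop :=
  ∀ ω, ∃ c : 𝕜, S ω (e ω) = c • e (θ ω)

/-- `V` is a set of positive measure with `V, θ V, …, θ^N V` pairwise disjoint, along which any
prescribed random unit vector on `V ∪ θ^N V` can be connected by an `η`-perturbation of `T`
with multipliers of modulus at least `η / 3`. (Measurable objects on a measurable subset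
are represented by measurable objects on `Ω`, of which only the values on the subset are used.) -/
structure IsConnectingTower (μ : Measure Ω) (θ : Ω → Ω) (T : Ω → H →L[𝕜] H) (η : ℝ) (N : ℕ)
    (V : Set Ω) : Prop where
  measurableSet : MeasurableSet V
  pos : 0 < μ V
  disjoint : ∀ i ≤ N, ∀ j ≤ N, i ≠ j → Disjoint (θ^[i] '' V) (θ^[j] '' V)
  connect : ∀ e : Ω → H, IsRandomUnit e →
    ∃ (S : Ω → H →L[𝕜] H) (β : Ω → 𝕜) (e' : Ω → H),
      IsBddRandomCompact μ S ∧ Measurable β ∧ IsRandomUnit e' ∧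
      (∀ ω ∈ V ∪ θ^[N] '' V, e' ω = e ω) ∧
      (∀ ω ∈ ⋃ i ∈ Finset.range N, θ^[i] '' V, η / 3 ≤ ‖β ω‖) ∧
      (∀ ω ∉ ⋃ i ∈ Finset.range N, θ^[i] '' V, S ω = T ω) ∧
      (∀ ω ∈ ⋃ i ∈ Finset.range N, θ^[i] '' V, ‖S ω - T ω‖ ≤ η) ∧
      ∀ ω ∈ V, ∀ i < N,
        S (θ^[i] ω) (e' (θ^[i] ω)) = β (θ^[i] ω) • e' (θ^[i + 1] ω)

/-- There are a perturbation `S` of `T` of size at most `3 ε (1 + ‖T‖_∞)` and an `S`-invariant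
random unit vector `e` satisfying the lower bound on `‖S(ω) e(ω)‖` and the good growth estimate
over `k * N` steps. -/
def HasGoodDirection (μ : Measure Ω) (θ : Ω → Ω) (T : Ω → H →L[𝕜] H) (ε : ℝ) (N k : ℕ) : Prop :=
  ∃ (S : Ω → H →L[𝕜] H) (e : Ω → H),
    IsBddRandomCompact μ S ∧
    IsRandomUnit e ∧
    IsInvariantDirection θ S e ∧
    supNorm μ (fun ω => S ω - T ω) ≤ 3 * ε * (1 + supNorm μ T) ∧
    (∀ ω, ε ^ (N + 1) / (1 + 2 * supNorm μ T) ^ (N - 1) ≤ ‖S ω (e ω)‖) ∧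
    ∀ ω, ε ^ (k + 4 * N) / (1 + 2 * supNorm μ T) ^ (4 * N) * ‖cocycle θ S (k * N) ω‖
      ≤ ‖cocycle θ S (k * N) ω (e ω)‖

end RandomCompact

namespace RandomCompact

/-! ### Recurrence in ergodic systems: thin bases and invariant sets of full measure. -/

section Measure

variable {Ω : Type*} [MeasurableSpace Ω] {μ : Measure Ω}

/-! A direction growing almost as fast as the cocycle is easy to produce over a finite block; the
difficulty is to make such directions fit together along an orbit, and the connecting set does this.
Its base `V` is thinned to a set `V'` whose points do not return within `k * N + N` steps
(`exists_subset_no_return`). By ergodicity almost every orbit alternates between passages through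
the tower of height `N` over `V'` and gaps longer than `k * N`. In a gap the direction starts at a
fixed unit vector `h` and follows its images under the perturbed operators; the next tower passage
leads it from wherever it has arrived back to `h`.

Gaps are cut into blocks of `N` steps, the last one possibly shorter. Inside a block, tilts `± ε h ⊗
h` keep the product `Q` of `m` factors at norm at least `ε ^ m`. At the block start a factor `R = id
± 2ε u ⊗ v` pushes the incoming direction `v` towards a near-maximizer `u` of `Q`, so that `‖Q R v‖
≥ 2ε ‖Q u‖ ≥ (3/2) ε ‖Q‖ ≥ ε ‖Q R‖`, since `‖R‖ ≤ 1 + 2ε ≤ 3/2`. Hence a complete block costs one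
factor `ε` in the comparison of the growth of `e` with the norm of the cocycle, whatever its length.
Such comparisons multiply along the orbit (`hasRatio_add`), and a window of `k * N` steps meets at
most one tower passage. Its cost is therefore at most one `ε` per block, plus a price depending only
on `N` for the passage and the incomplete blocks (`hasRatio_window`).

Connecting sets exist for all large `N` (`isConnectingTower_of_norm_cocycle_lt`): nullity gives
`‖T^N‖ < ε ^ N` on a set of positive measure. A direction following its images from there must at
some step be contracted below `ε`, and can then be redirected at cost `O(ε)`. It is redirected to a
vector that is again contracted below `ε`, which exists because a compact operator in infinite
dimension is not bounded below. So redirection remains possible up to the last step, where the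
target is prescribed. -/

/-- Of a set split into two parts of positive measure, one part has at most half the measure;
iterate. -/
theorem NonAtomic.exists_subset_measure_le [IsFiniteMeasure μ] (hμ : NonAtomic μ) {A : Set Ω}
    (hA : MeasurableSet A) (h0 : 0 < μ A) (n : ℕ) :
    ∃ B ⊆ A, MeasurableSet B ∧ 0 < μ B ∧ 2 ^ n * μ B ≤ μ A := by
  induction n with
  | zero => exact ⟨A, subset_rfl, hA, h0, by simp⟩
  | succ n ih =>
    obtain ⟨B, hBA, hB, hB0, hBn⟩ := ih
    obtain ⟨C, hCB, hC, hC0, hCl⟩ := hμ B hB hB0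
    have hadd : μ C + μ (B \ C) = μ B := by
      rw [← measure_inter_add_sdiff B hC, Set.inter_eq_self_of_subset_right hCB]
    have hD0 : 0 < μ (B \ C) := by
      rw [pos_iff_ne_zero]
      intro h
      rw [h, add_zero] at hadd
      exact hCl.ne hadd
    have key : ∀ x : ℝ≥0∞, 2 * x ≤ μ B → 2 ^ (n + 1) * x ≤ μ A := fun x hx => by
      rw [pow_succ, mul_assoc]
      exact (mul_le_mul_right hx _).trans hBn
    rcases le_total (μ C) (μ (B \ C)) with h | h
    · exact ⟨C, hCB.trans hBA, hC, hC0, key _ (by rw [two_mul, ← hadd]; gcongr)⟩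
    · exact ⟨B \ C, Set.sdiff_subset.trans hBA, hB.diff hC, hD0,
        key _ (by rw [two_mul, ← hadd]; gcongr)⟩

theorem measurableSet_iterate_preimage {f : Ω → Ω} (hf : Measurable f) (n : ℕ) {A : Set Ω}
    (hA : MeasurableSet A) : MeasurableSet (f^[n] ⁻¹' A) :=
  (hf.iterate n) hA

/-- In an ergodic system without atoms, every set of positive measure contains a set of positive
measure whose points do not return to it within a prescribed time. -/
theorem exists_subset_no_return [IsProbabilityMeasure μ] (hμ : NonAtomic μ) {f : Ω → Ω}
    (hf : Ergodic f μ) {A : Set Ω} (hA : MeasurableSet A) (h0 : 0 < μ A) (L : ℕ) :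
    ∃ B ⊆ A, MeasurableSet B ∧ 0 < μ B ∧ ∀ ω ∈ B, ∀ i, 1 ≤ i → i ≤ L → f^[i] ω ∉ B := by
  -- With `L + 1` halvings, the union of `L` preimages of `B` has measure at most `L * μ B < 1`.
  obtain ⟨B, hBA, hB, hB0, hBL⟩ := hμ.exists_subset_measure_le hA h0 (L + 1)
  have hmeas : ∀ i, MeasurableSet (f^[i] ⁻¹' B) := fun i =>
    measurableSet_iterate_preimage hf.measurable i hB
  have hpres : ∀ i, μ (f^[i] ⁻¹' B) = μ B := fun i =>
    (hf.toMeasurePreserving.iterate i).measure_preimage hB.nullMeasurableSet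
  refine ⟨B \ ⋃ i ∈ Finset.Icc 1 L, f^[i] ⁻¹' B, Set.sdiff_subset.trans hBA,
    hB.diff (Finset.measurableSet_biUnion _ fun i _ => hmeas i), ?_, ?_⟩
  · rw [pos_iff_ne_zero]
    intro hzero
    set C : Set Ω := ⋃ i ∈ Finset.Icc 1 L, f^[i] ⁻¹' B with hCdef
    have hCm : MeasurableSet C := Finset.measurableSet_biUnion _ fun i _ => hmeas i
    have hBC : B ≤ᵐ[μ] C := by
      rw [ae_le_set]; exact hzero
    have hCpos : 0 < μ C := hB0.trans_le (measure_mono_ae hBC)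
    -- A point that enters `B` at a time `i ≥ 2` is still in `C` one step later. For `i = 1` it
    -- lands in `B`, hence in `C` unless it lands in the null set `B \ C`.
    have hCle : C ≤ᵐ[μ] f ⁻¹' C := by
      have hn : μ (f ⁻¹' (B \ C)) = 0 := by
        rw [hf.toMeasurePreserving.measure_preimage (hB.diff hCm).nullMeasurableSet, hzero]
      rw [ae_le_set]
      refine measure_mono_null ?_ hn
      rintro ω ⟨h1, h2⟩
      simp only [hCdef, Set.mem_iUnion, Finset.mem_Icc, Set.mem_preimage, exists_prop] at h1
      obtain ⟨i, ⟨hi1, hi2⟩, hi⟩ := h1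
      obtain ⟨j, rfl⟩ : ∃ j, i = j + 1 := ⟨i - 1, by omega⟩
      rw [Function.iterate_succ_apply] at hi
      rcases Nat.eq_zero_or_pos j with rfl | hj
      · exact ⟨hi, h2⟩
      · exact absurd (by
          simp only [hCdef, Set.mem_preimage, Set.mem_iUnion, Finset.mem_Icc, exists_prop]
          exact ⟨j, ⟨hj, by omega⟩, hi⟩) h2
    have hCone : μ C = 1 := by
      rcases hf.ae_empty_or_univ_of_ae_le_preimage hCm.nullMeasurableSet hCle with h | h
      · rw [measure_congr h, measure_empty] at hCpos
        exact absurd hCpos (lt_irrefl _)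
      · rw [measure_congr h, measure_univ]
    have hle : μ C ≤ L * μ B := by
      refine (measure_biUnion_finset_le _ _).trans ?_
      simp [hpres]
    have hlt : (L : ℝ≥0∞) * μ B < 2 ^ (L + 1) * μ B := by
      refine ENNReal.mul_lt_mul_left hB0.ne' (measure_ne_top _ _) ?_
      have : L < 2 ^ (L + 1) := (Nat.lt_succ_self L).trans Nat.lt_two_pow_self
      exact_mod_cast this
    have : μ C < 1 := hle.trans_lt (hlt.trans_le (hBL.trans prob_le_one))
    exact this.ne hCone
  · rintro ω ⟨hω, hω'⟩ i h1 hi ⟨h2, -⟩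
    exact hω' (by
      simp only [Set.mem_iUnion, Finset.mem_Icc, exists_prop]
      exact ⟨i, ⟨h1, hi⟩, h2⟩)

theorem ae_exists_iterate_mem [IsFiniteMeasure μ] {f : Ω → Ω} (hf : Ergodic f μ) {V : Set Ω}
    (hV : MeasurableSet V) (h0 : 0 < μ V) : ∀ᵐ ω ∂μ, ∃ n, f^[n] ω ∈ V := by
  have hm : MeasurableSet {ω | ∃ n, f^[n] ω ∈ V} := by
    simp only [Set.ofPred_exists]
    exact MeasurableSet.iUnion fun n => measurableSet_iterate_preimage hf.measurable n hV
  have hsub : f ⁻¹' {ω | ∃ n, f^[n] ω ∈ V} ⊆ {ω | ∃ n, f^[n] ω ∈ V} := by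
    rintro ω ⟨n, hn⟩
    exact ⟨n + 1, hn⟩
  rcases hf.ae_empty_or_univ_of_preimage_ae_le hm.nullMeasurableSet
    (LE.le.eventuallyLE hsub) with h | h
  · have : μ V ≤ 0 := by
      rw [← measure_empty (μ := μ), ← measure_congr h]
      exact measure_mono fun ω hω => ⟨0, hω⟩
    exact absurd h0 this.not_gt
  · filter_upwards [h] with ω hω
    exact hω.mpr trivial

theorem iterate_symm_iterate (θ : Ω ≃ᵐ Ω) (n : ℕ) (ω : Ω) : θ.symm^[n] (θ^[n] ω) = ω :=
  (Function.LeftInverse.iterate θ.symm_apply_apply n) ω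

theorem iterate_iterate_symm (θ : Ω ≃ᵐ Ω) (n : ℕ) (ω : Ω) : θ^[n] (θ.symm^[n] ω) = ω :=
  (Function.LeftInverse.iterate θ.apply_symm_apply n) ω

/-- Almost every point lies in an invariant measurable set of points of a given full measure set
whose orbits visit `V` in the future and in the past. -/
theorem exists_invariant_conull [IsFiniteMeasure μ] {θ : Ω ≃ᵐ Ω} (hθ : Ergodic θ μ) {V : Set Ω}
    (hV : MeasurableSet V) (h0 : 0 < μ V) {p : Ω → Prop} (hp : ∀ᵐ ω ∂μ, p ω) :
    ∃ G : Set Ω, MeasurableSet G ∧ (∀ᵐ ω ∂μ, ω ∈ G) ∧ (∀ ω, θ ω ∈ G ↔ ω ∈ G) ∧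
      ∀ ω ∈ G, p ω ∧ (∃ n, θ^[n] ω ∈ V) ∧ ∃ n, θ.symm^[n] ω ∈ V := by
  have hθ' := hθ.symm
  have hall : ∀ᵐ ω ∂μ, p ω ∧ (∃ n, θ^[n] ω ∈ V) ∧ ∃ n, θ.symm^[n] ω ∈ V := by
    filter_upwards [hp, ae_exists_iterate_mem hθ hV h0, ae_exists_iterate_mem hθ' hV h0]
      with ω h1 h2 h3 using ⟨h1, h2, h3⟩
  obtain ⟨X, hX, hXm, hXp⟩ : ∃ X : Set Ω, X ⊆ {ω | p ω ∧ (∃ n, θ^[n] ω ∈ V) ∧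
      ∃ n, θ.symm^[n] ω ∈ V} ∧ MeasurableSet X ∧ X ∈ ae μ := by
    obtain ⟨X, h1, h2, h3⟩ := exists_measurable_superset_of_null (ae_iff.mp hall)
    refine ⟨Xᶜ, Set.compl_subset_comm.mp h1, h2.compl, ?_⟩
    rw [mem_ae_iff, compl_compl]
    exact h3
  -- Keeping the points whose whole two-sided orbit stays in `X` gives strict invariance, not only
  -- invariance up to null sets.
  refine ⟨{ω | (∀ n, θ^[n] ω ∈ X) ∧ ∀ n, θ.symm^[n] ω ∈ X}, ?_, ?_, ?_, ?_⟩
  · simp only [Set.ofPred_and, Set.ofPred_forall]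
    exact (MeasurableSet.iInter fun n => measurableSet_iterate_preimage θ.measurable n hXm).inter
      (MeasurableSet.iInter fun n => measurableSet_iterate_preimage θ.symm.measurable n hXm)
  · have h1 : ∀ᵐ ω ∂μ, ∀ n, θ^[n] ω ∈ X := ae_all_iff.mpr fun n =>
      (hθ.toMeasurePreserving.iterate n).quasiMeasurePreserving.ae hXp
    have h2 : ∀ᵐ ω ∂μ, ∀ n, θ.symm^[n] ω ∈ X := ae_all_iff.mpr fun n =>
      (hθ'.toMeasurePreserving.iterate n).quasiMeasurePreserving.ae hXp
    filter_upwards [h1, h2] with ω a b using ⟨a, b⟩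
  · intro ω
    constructor
    · rintro ⟨a, b⟩
      refine ⟨fun n => ?_, fun n => ?_⟩
      · cases n with
        | zero => simpa using b 1
        | succ n => simpa using a n
      · simpa using b (n + 1)
    · rintro ⟨a, b⟩
      refine ⟨fun n => ?_, fun n => ?_⟩
      · simpa using a (n + 1)
      · cases n with
        | zero => simpa using a 1
        | succ n => simpa using b n
  · rintro ω ⟨a, -⟩
    exact hX (a 0)

theorem measurable_sInf_nat {p : Ω → ℕ → Prop} (hp : ∀ n, MeasurableSet {ω | p ω n}) :
    Measurable fun ω => sInf {n | p ω n} := by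
  classical
  have hE : MeasurableSet {ω | ∃ n, p ω n} := by
    simp only [Set.ofPred_exists]
    exact MeasurableSet.iUnion hp
  -- The added alternative makes the search stop at `0` when there is no witness, in agreement with
  -- `sInf ∅ = 0`.
  have hex : ∀ ω, ∃ n, p ω n ∨ ¬ ∃ n, p ω n := fun ω => by
    by_cases h : ∃ n, p ω n
    · exact h.imp fun n hn => Or.inl hn
    · exact ⟨0, Or.inr h⟩
  have hfind := measurable_find hex fun n => (hp n).union hE.compl
  convert hfind using 2 with ω
  by_cases h : ∃ n, p ω n
  · refine ((Nat.find_eq_iff _).mpr ⟨Or.inl (Nat.sInf_mem (s := {n | p ω n}) h), ?_⟩).symm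
    rintro n hn (hp' | hp')
    · exact Nat.notMem_of_lt_sInf (s := {n | p ω n}) hn hp'
    · exact hp' h
  · rw [eq_comm, (Nat.find_eq_zero _).mpr (Or.inr h), eq_comm, Nat.sInf_eq_zero]
    right
    ext n
    simpa using fun hn => h ⟨n, hn⟩

end Measure

/-! ### Hitting times. -/

section Hitting

variable {Ω : Type*}

/-- The first time at which the forward orbit is in `V` (`0` if there is none). -/
noncomputable def hitTime (f : Ω → Ω) (V : Set Ω) (ω : Ω) : ℕ :=
  sInf {n | f^[n] ω ∈ V}

theorem measurable_hitTime [MeasurableSpace Ω] {f : Ω → Ω} (hf : Measurable f) {V : Set Ω}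
    (hV : MeasurableSet V) :
    Measurable (hitTime f V) :=
  measurable_sInf_nat fun n => measurableSet_iterate_preimage hf n hV

theorem hitTime_mem {f : Ω → Ω} {V : Set Ω} {ω : Ω} (h : ∃ n, f^[n] ω ∈ V) :
    f^[hitTime f V ω] ω ∈ V :=
  Nat.sInf_mem (s := {n | f^[n] ω ∈ V}) h

theorem hitTime_le {f : Ω → Ω} {V : Set Ω} {ω : Ω} {n : ℕ} (h : f^[n] ω ∈ V) :
    hitTime f V ω ≤ n :=
  Nat.sInf_le (s := {n | f^[n] ω ∈ V}) h

theorem hitTime_eq_zero {f : Ω → Ω} {V : Set Ω} {ω : Ω} (h : ω ∈ V) : hitTime f V ω = 0 :=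
  Nat.le_zero.mp (hitTime_le (n := 0) h)

theorem hitTime_eq {f : Ω → Ω} {V : Set Ω} {ω : Ω} {n : ℕ} (h : f^[n] ω ∈ V)
    (h' : ∀ i < n, f^[i] ω ∉ V) : hitTime f V ω = n := by
  refine le_antisymm (hitTime_le h) (not_lt.mp fun hlt => ?_)
  exact h' _ hlt (hitTime_mem ⟨n, h⟩)

theorem hitTime_succ {f : Ω → Ω} {V : Set Ω} {ω : Ω} (hω : ω ∉ V) (h : ∃ n, f^[n] (f ω) ∈ V) :
    hitTime f V ω = hitTime f V (f ω) + 1 := by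
  refine hitTime_eq (hitTime_mem h) fun i hi hmem => ?_
  cases i with
  | zero => exact hω hmem
  | succ i => exact absurd (hitTime_le (V := V) (f := f) (ω := f ω) (n := i) hmem) (by omega)

end Hitting

/-! ### Compact operators, unit vectors, cocycles and measurable selections. -/

section Operators

set_option linter.unusedSectionVars false

variable {𝕜 H Ω : Type*} [RCLike 𝕜] [NormedAddCommGroup H] [InnerProductSpace 𝕜 H]

theorem isCompactOperator_rankOne (x y : H) :
    IsCompactOperator (InnerProductSpace.rankOne 𝕜 x y : H →L[𝕜] H) := by
  have h : IsCompactOperator (ContinuousLinearMap.toSpanSingleton 𝕜 x : 𝕜 →L[𝕜] H) :=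
    isCompactOperator_of_locallyCompactSpace_rng
      (ContinuousLinearMap.toSpanSingleton 𝕜 x : 𝕜 →L[𝕜] H)
  exact h.comp_clm (innerSL 𝕜 y)

/-- A sign `s` such that `x + s y` is at least as long as `y`. -/
noncomputable def growSign (𝕜 : Type*) {H : Type*} [RCLike 𝕜] [NormedAddCommGroup H]
    (x y : H) : 𝕜 :=
  if ‖y‖ ≤ ‖x + y‖ then 1 else -1

theorem norm_growSign (x y : H) : ‖growSign 𝕜 x y‖ = 1 := by
  unfold growSign
  split_ifs <;> simp

/-- Since `2y = (x + y) - (x - y)`, the vectors `x + y` and `x - y` cannot both be shorter than `y`.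
-/
theorem le_norm_add_growSign_smul (x y : H) : ‖y‖ ≤ ‖x + growSign 𝕜 x y • y‖ := by
  unfold growSign
  split_ifs with h
  · simpa using h
  · have h1 : ‖(2 : 𝕜) • y‖ ≤ ‖x + y‖ + ‖x - y‖ := by
      have : (2 : 𝕜) • y = (x + y) - (x - y) := by rw [two_smul]; abel
      rw [this]
      exact norm_sub_le _ _
    rw [norm_smul, RCLike.norm_ofNat] at h1
    rw [neg_one_smul, ← sub_eq_add_neg]
    linarith

/-- The unit vector in the direction of `x`, with the value `h` at `x = 0`. -/
noncomputable def direction (𝕜 : Type*) {H : Type*} [RCLike 𝕜] [NormedAddCommGroup H]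
    [InnerProductSpace 𝕜 H] (h x : H) : H :=
  if ‖x‖ = 0 then h else ((‖x‖⁻¹ : ℝ) : 𝕜) • x

theorem norm_direction {h : H} (hh : ‖h‖ = 1) (x : H) : ‖direction 𝕜 h x‖ = 1 := by
  unfold direction
  split_ifs with h0
  · exact hh
  · rw [norm_smul, RCLike.norm_ofReal, abs_inv, abs_norm, inv_mul_cancel₀ h0]

theorem norm_smul_direction (h x : H) : ((‖x‖ : ℝ) : 𝕜) • direction 𝕜 h x = x := by
  unfold direction
  split_ifs with h0
  · rw [norm_eq_zero.mp h0]; simp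
  · rw [smul_smul, ← RCLike.ofReal_mul, mul_inv_cancel₀ h0, RCLike.ofReal_one, one_smul]

theorem exists_norm_eq_one (hH : ¬ FiniteDimensional 𝕜 H) : ∃ h : H, ‖h‖ = 1 := by
  have : Nontrivial H := by
    by_contra hn
    rw [not_nontrivial_iff_subsingleton] at hn
    exact hH inferInstance
  obtain ⟨x, hx⟩ := exists_ne (0 : H)
  refine ⟨((‖x‖⁻¹ : ℝ) : 𝕜) • x, ?_⟩
  rw [norm_smul, RCLike.norm_ofReal, abs_inv, abs_norm, inv_mul_cancel₀ (norm_ne_zero_iff.mpr hx)]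

/-- Otherwise `A` would be a closed embedding, and the closed unit ball, contained in the preimage
of a compact set, would be compact. -/
theorem exists_unit_norm_apply_lt [CompleteSpace H] (hH : ¬ FiniteDimensional 𝕜 H)
    {A : H →L[𝕜] H} (hA : IsCompactOperator A) {ε : ℝ} (hε : 0 < ε) :
    ∃ v : H, ‖v‖ = 1 ∧ ‖A v‖ < ε := by
  by_contra! hcon
  have hbd : ∀ v, ‖v‖ ≤ ε⁻¹ * ‖A v‖ := fun v => by
    rcases eq_or_ne v 0 with rfl | hv
    · simp
    · have hv' := norm_ne_zero_iff.mpr hv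
      have := hcon (((‖v‖⁻¹ : ℝ) : 𝕜) • v) (by
        rw [norm_smul, RCLike.norm_ofReal, abs_inv, abs_norm, inv_mul_cancel₀ hv'])
      rw [map_smul, norm_smul, RCLike.norm_ofReal, abs_inv, abs_norm, inv_mul_eq_div,
        le_div_iff₀ (norm_pos_iff.mpr hv)] at this
      rw [inv_mul_eq_div, le_div_iff₀ hε]
      linarith
  have hanti : AntilipschitzWith (Real.toNNReal ε⁻¹) A :=
    ContinuousLinearMap.antilipschitz_of_bound A fun x => by
      rw [Real.coe_toNNReal _ (inv_pos.mpr hε).le]; exact hbd x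
  have hcl := hanti.isClosedEmbedding A.uniformContinuous
  obtain ⟨K, hK, hsub⟩ := hA.image_closedBall_subset_compact (f := (A : H →ₗ[𝕜] H)) 1
  refine hH (FiniteDimensional.of_isCompact_closedBall₀ 𝕜 zero_lt_one
    ((hcl.isCompact_preimage hK).of_isClosed_subset Metric.isClosed_closedBall ?_))
  exact Set.image_subset_iff.mp hsub

theorem exists_unit_lt_norm_apply {h : H} (hh : ‖h‖ = 1) (A : H →L[𝕜] H) {r : ℝ} (hr : r < 1)
    (hr0 : 0 ≤ r) (hA : A ≠ 0) :
    ∃ v : H, ‖v‖ = 1 ∧ r * ‖A‖ < ‖A v‖ := by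
  by_contra! hcon
  have hpos : 0 < ‖A‖ := norm_pos_iff.mpr hA
  have : ‖A‖ ≤ r * ‖A‖ := A.opNorm_le_bound (by positivity) fun v => by
    have h1 := hcon (direction 𝕜 h v) (norm_direction hh v)
    conv_lhs => rw [← norm_smul_direction (𝕜 := 𝕜) h v]
    rw [map_smul, norm_smul, RCLike.norm_ofReal, abs_norm, mul_comm]
    gcongr
  nlinarith

section Cocycle

theorem cocycle_add (θ : Ω → Ω) (S : Ω → H →L[𝕜] H) (a b : ℕ) (ω : Ω) :
    cocycle θ S (a + b) ω = (cocycle θ S b (θ^[a] ω)).comp (cocycle θ S a ω) := by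
  induction b with
  | zero => rfl
  | succ b ih =>
    change (S (θ^[a + b] ω)).comp (cocycle θ S (a + b) ω) = _
    rw [ih, add_comm a b, Function.iterate_add_apply]
    rfl

theorem cocycle_one (θ : Ω → Ω) (S : Ω → H →L[𝕜] H) (ω : Ω) : cocycle θ S 1 ω = S ω := rfl

theorem cocycle_succ' (θ : Ω → Ω) (S : Ω → H →L[𝕜] H) (n : ℕ) (ω : Ω) :
    cocycle θ S (n + 1) ω = (cocycle θ S n (θ ω)).comp (S ω) := by
  rw [add_comm, cocycle_add]
  rfl

end Cocycle

section Measurability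

variable [MeasurableSpace H] [BorelSpace H] [TopologicalSpace.SeparableSpace H]
  [MeasurableSpace Ω]

/-- `(x, ω) ↦ A ω x` is a Carathéodory function on a separable space, hence jointly measurable. -/
theorem measurable_apply {A : Ω → H →L[𝕜] H} (hA : ∀ x, Measurable fun ω => A ω x)
    {f : Ω → H} (hf : Measurable f) : Measurable fun ω => A ω (f ω) := by
  have : SecondCountableTopology H := UniformSpace.secondCountable_of_separable H
  have h : Measurable (Function.uncurry fun (x : H) (ω : Ω) => A ω x) :=
    measurable_uncurry_of_continuous_of_measurable (fun ω => (A ω).continuous) hA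
  exact h.comp (hf.prodMk measurable_id)

theorem measurable_opNorm {A : Ω → H →L[𝕜] H} (hA : ∀ x, Measurable fun ω => A ω x) :
    Measurable fun ω => ‖A ω‖ := by
  refine measurable_of_Iic fun c => ?_
  rcases lt_or_ge c 0 with hc | hc
  · convert MeasurableSet.empty (α := Ω)
    ext ω
    simpa using hc.trans_le (norm_nonneg (A ω))
  · have : (fun ω => ‖A ω‖) ⁻¹' Set.Iic c
        = ⋂ n, {ω | ‖A ω (TopologicalSpace.denseSeq H n)‖ ≤
          c * ‖TopologicalSpace.denseSeq H n‖} := by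
      ext ω
      simp only [Set.mem_preimage, Set.mem_Iic, Set.mem_iInter, Set.mem_ofPred_eq]
      refine ⟨fun h n => (A ω).le_of_opNorm_le h _, fun h => (A ω).opNorm_le_bound hc fun x => ?_⟩
      have hcl : IsClosed {x | ‖A ω x‖ ≤ c * ‖x‖} :=
        isClosed_le (A ω).continuous.norm (continuous_const.mul continuous_norm)
      exact (TopologicalSpace.denseRange_denseSeq H).induction_on x hcl h
    rw [this]
    exact MeasurableSet.iInter fun n => measurableSet_le (hA _).norm measurable_const

theorem measurable_add_smul_rankOne {A : Ω → H →L[𝕜] H} (hA : ∀ x, Measurable fun ω => A ω x)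
    {a : Ω → 𝕜} (ha : Measurable a) {f g : Ω → H} (hf : Measurable f) (hg : Measurable g) (x : H) :
    Measurable fun ω => (A ω + a ω • InnerProductSpace.rankOne 𝕜 (f ω) (g ω)) x := by
  have : SecondCountableTopology H := UniformSpace.secondCountable_of_separable H
  simp only [add_apply, smul_apply,
    InnerProductSpace.rankOne_apply]
  exact (hA x).add (ha.smul ((hg.inner measurable_const).smul hf))

theorem measurable_growSign {f g : Ω → H} (hf : Measurable f) (hg : Measurable g) :
    Measurable fun ω => growSign 𝕜 (f ω) (g ω) := by
  have : SecondCountableTopology H := UniformSpace.secondCountable_of_separable H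
  exact Measurable.ite (measurableSet_le hg.norm (hf.add hg).norm) measurable_const
    measurable_const

theorem measurable_direction (h : H) {f : Ω → H} (hf : Measurable f) :
    Measurable fun ω => direction 𝕜 h (f ω) := by
  have : SecondCountableTopology H := UniformSpace.secondCountable_of_separable H
  refine Measurable.ite (measurableSet_eq_fun hf.norm measurable_const) measurable_const ?_
  exact (RCLike.measurable_ofReal.comp hf.norm.inv).smul hf

/-- A measurable selection of unit vectors satisfying an open condition. -/
theorem exists_measurable_unit {h : H} (hh : ‖h‖ = 1) {p : Ω → H → Prop}
    (hp : ∀ x, MeasurableSet {ω | p ω x}) (hopen : ∀ ω, IsOpen {x | p ω x})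
    (hex : ∀ ω, ∃ x, ‖x‖ = 1 ∧ p ω x) :
    ∃ u : Ω → H, Measurable u ∧ ∀ ω, ‖u ω‖ = 1 ∧ p ω (u ω) := by
  have : SecondCountableTopology H := UniformSpace.secondCountable_of_separable H
  have : Nonempty (Metric.sphere (0 : H) 1) := ⟨⟨h, by simpa using hh⟩⟩
  let x : ℕ → Metric.sphere (0 : H) 1 := TopologicalSpace.denseSeq _
  have hn : ∀ ω, ∃ n, p ω (x n) := fun ω => by
    obtain ⟨v, hv, hpv⟩ := hex ω
    obtain ⟨n, hn⟩ := (TopologicalSpace.denseRange_denseSeq (Metric.sphere (0 : H) 1)).exists_mem_open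
      ((hopen ω).preimage continuous_subtype_val) ⟨⟨v, by simpa using hv⟩, hpv⟩
    exact ⟨n, hn⟩
  -- The selection takes the first member of a dense sequence of the sphere that meets the open
  -- condition.
  refine ⟨fun ω => x (sInf {n | p ω (x n)}), ?_, fun ω => ⟨by simp, ?_⟩⟩
  · exact (measurable_from_top (f := fun n => (x n : H))).comp
      (measurable_sInf_nat fun n => hp (x n))
  · exact Nat.sInf_mem (s := {n | p ω (x n)}) (hn ω)

theorem measurable_cocycle {θ : Ω → Ω} (hθ : Measurable θ) {S : Ω → H →L[𝕜] H}
    (hS : ∀ x, Measurable fun ω => S ω x) (n : ℕ) (x : H) :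
    Measurable fun ω => cocycle θ S n ω x := by
  induction n with
  | zero => exact measurable_const
  | succ n ih =>
    exact measurable_apply (A := fun ω => S (θ^[n] ω))
      (fun x => (hS x).comp (hθ.iterate n)) ih

/-- Countable gluing: evaluating a sequence of measurable maps at a measurable index. -/
theorem measurable_index {β : Type*} [MeasurableSpace β] {F : ℕ → Ω → β}
    (hF : ∀ n, Measurable (F n)) {i : Ω → ℕ} (hi : Measurable i) {g : Ω → Ω} (hg : Measurable g) :
    Measurable fun ω => F (i ω) (g ω) :=
  (measurable_from_prod_countable_right (f := fun q : ℕ × Ω => F q.1 q.2) hF).comp (hi.prodMk hg)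

theorem ae_norm_le_supNorm {μ : Measure Ω} {T : Ω → H →L[𝕜] H} (hT : IsBddRandomCompact μ T) :
    ∀ᵐ ω ∂μ, ‖T ω‖ ≤ supNorm μ T := by
  filter_upwards [ae_le_eLpNormEssSup (f := T) (μ := μ)] with ω hω
  have := ENNReal.toReal_mono hT.essBdd.ne hω
  simpa [supNorm] using this

theorem IsBddRandomCompact.of_norm_sub_le {μ : Measure Ω} {S T : Ω → H →L[𝕜] H}
    (hT : IsBddRandomCompact μ T) (hc : ∀ ω, IsCompactOperator (S ω))
    (hm : ∀ x, Measurable fun ω => S ω x) {C : ℝ} (hC : ∀ᵐ ω ∂μ, ‖S ω - T ω‖ ≤ C) :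
    IsBddRandomCompact μ S := by
  refine ⟨hc, hm, eLpNormEssSup_lt_top_of_ae_bound (C := C + supNorm μ T) ?_⟩
  filter_upwards [hC, ae_norm_le_supNorm hT] with ω h1 h2
  calc ‖S ω‖ = ‖(S ω - T ω) + T ω‖ := by rw [sub_add_cancel]
    _ ≤ _ := (norm_add_le _ _).trans (add_le_add h1 h2)

theorem supNorm_le {μ : Measure Ω} {S : Ω → H →L[𝕜] H} {C : ℝ} (h0 : 0 ≤ C)
    (hC : ∀ᵐ ω ∂μ, ‖S ω‖ ≤ C) : supNorm μ S ≤ C :=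
  ENNReal.toReal_le_of_le_ofReal h0 (eLpNormEssSup_le_of_ae_bound hC)

end Measurability

end Operators

/-! ### Towers over a set without early returns. -/

section Tower

variable {Ω : Type*}

theorem mem_tower {θ : Ω → Ω} {N : ℕ} {V : Set Ω} {ω : Ω} :
    ω ∈ ⋃ i ∈ Finset.range N, θ^[i] '' V ↔ ∃ i < N, ∃ τ ∈ V, θ^[i] τ = ω := by
  simp

variable [MeasurableSpace Ω]

theorem symm_iterate_iterate_of_le (θ : Ω ≃ᵐ Ω) {i j : ℕ} (h : j ≤ i) (ω : Ω) :
    θ.symm^[j] (θ^[i] ω) = θ^[i - j] ω := by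
  obtain ⟨k, rfl⟩ := Nat.exists_eq_add_of_le h
  rw [Function.iterate_add_apply, iterate_symm_iterate, Nat.add_sub_cancel_left]

theorem image_iterate_eq (θ : Ω ≃ᵐ Ω) (n : ℕ) (V : Set Ω) : θ^[n] '' V = θ.symm^[n] ⁻¹' V :=
  congrFun (Set.image_eq_preimage_of_inverse (iterate_symm_iterate θ n)
    (iterate_iterate_symm θ n)) V

theorem measurableSet_image_iterate (θ : Ω ≃ᵐ Ω) (n : ℕ) {V : Set Ω} (hV : MeasurableSet V) :
    MeasurableSet (θ^[n] '' V) := by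
  rw [image_iterate_eq]
  exact measurableSet_iterate_preimage θ.symm.measurable n hV

theorem measurableSet_tower (θ : Ω ≃ᵐ Ω) (N : ℕ) {V : Set Ω} (hV : MeasurableSet V) :
    MeasurableSet (⋃ i ∈ Finset.range N, θ^[i] '' V) :=
  Finset.measurableSet_biUnion _ fun i _ => measurableSet_image_iterate θ i hV

/-- The backward hitting time recovers the level of a point in the tower; disjointness of the levels
and measurability in the level both rest on this. -/
theorem hitTime_symm_iterate {θ : Ω ≃ᵐ Ω} {V : Set Ω} {L : ℕ}
    (hV : ∀ ω ∈ V, ∀ i, 1 ≤ i → i ≤ L → θ^[i] ω ∉ V) {τ : Ω} (hτ : τ ∈ V) {i : ℕ} (hi : i ≤ L) :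
    hitTime θ.symm V (θ^[i] τ) = i := by
  refine hitTime_eq (by rwa [iterate_symm_iterate]) fun j hj => ?_
  rw [symm_iterate_iterate_of_le θ hj.le]
  exact hV τ hτ _ (by omega) (by omega)

theorem disjoint_image_iterate {θ : Ω ≃ᵐ Ω} {V : Set Ω} {L : ℕ}
    (hV : ∀ ω ∈ V, ∀ i, 1 ≤ i → i ≤ L → θ^[i] ω ∉ V) {i j : ℕ} (hi : i ≤ L) (hj : j ≤ L)
    (hij : i ≠ j) : Disjoint (θ^[i] '' V) (θ^[j] '' V) := by
  rw [Set.disjoint_left]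
  rintro _ ⟨τ, hτ, rfl⟩ ⟨τ', hτ', h⟩
  have h1 := hitTime_symm_iterate hV hτ hi
  rw [← h, hitTime_symm_iterate hV hτ' hj] at h1
  exact hij h1.symm

end Tower

/-! ### Existence of connecting sets. -/

section Connecting

set_option linter.unusedSectionVars false

variable {𝕜 H Ω : Type*} [RCLike 𝕜] [NormedAddCommGroup H] [InnerProductSpace 𝕜 H]

/-- Follow the direction of the image as long as the image is not short, otherwise jump to `u`. -/
noncomputable def pursuit (θ : Ω → Ω) (T : Ω → H →L[𝕜] H) (ε : ℝ) (h : H) (u e : Ω → H) :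
    ℕ → Ω → H
  | 0, ω => e ω
  | n + 1, ω =>
    if ε ≤ ‖T (θ^[n] ω) (pursuit θ T ε h u e n ω)‖ then
      direction 𝕜 h (T (θ^[n] ω) (pursuit θ T ε h u e n ω))
    else u (θ^[n + 1] ω)

theorem norm_pursuit {θ : Ω → Ω} {T : Ω → H →L[𝕜] H} {ε : ℝ} {h : H} {u e : Ω → H}
    (hh : ‖h‖ = 1) (hu : ∀ ω, ‖u ω‖ = 1) (he : ∀ ω, ‖e ω‖ = 1) (n : ℕ) (ω : Ω) :
    ‖pursuit θ T ε h u e n ω‖ = 1 := by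
  cases n with
  | zero => exact he ω
  | succ n =>
    rw [pursuit]
    split_ifs
    · exact norm_direction hh _
    · exact hu _

/-- After a jump to `u` the next image is short, which forces another jump. So a long image at time
`n` means that no jump has occurred, and the pursuit is the true orbit direction with growth at
least `ε` at every step. -/
theorem pow_le_norm_cocycle_of_pursuit {θ : Ω → Ω} {T : Ω → H →L[𝕜] H} {ε : ℝ} {h : H}
    {u e : Ω → H} (hε : 0 ≤ ε) (hu' : ∀ ω, ‖T ω (u ω)‖ < ε) (n : ℕ) (ω : Ω)
    (hn : ε ≤ ‖T (θ^[n] ω) (pursuit θ T ε h u e n ω)‖) :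
    ∃ c : 𝕜, ε ^ (n + 1) ≤ ‖c‖ ∧ cocycle θ T (n + 1) ω (e ω)
      = c • direction 𝕜 h (T (θ^[n] ω) (pursuit θ T ε h u e n ω)) := by
  induction n with
  | zero =>
    refine ⟨((‖T ω (e ω)‖ : ℝ) : 𝕜), by simpa [pursuit] using hn, ?_⟩
    change T ω (e ω) = _ • direction 𝕜 h (T ω (e ω))
    rw [norm_smul_direction]
  | succ n ih =>
    by_cases hc : ε ≤ ‖T (θ^[n] ω) (pursuit θ T ε h u e n ω)‖
    · obtain ⟨c, hc1, hc2⟩ := ih hc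
      have hp : pursuit θ T ε h u e (n + 1) ω
          = direction 𝕜 h (T (θ^[n] ω) (pursuit θ T ε h u e n ω)) := by
        rw [pursuit, if_pos hc]
      rw [← hp] at hc2
      refine ⟨c * ((‖T (θ^[n + 1] ω) (pursuit θ T ε h u e (n + 1) ω)‖ : ℝ) : 𝕜), ?_, ?_⟩
      · rw [norm_mul, RCLike.norm_ofReal, abs_norm, pow_succ]
        exact mul_le_mul hc1 hn hε (norm_nonneg _)
      · change T (θ^[n + 1] ω) (cocycle θ T (n + 1) ω (e ω)) = _
        rw [hc2, map_smul, mul_smul, norm_smul_direction]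
    · rw [pursuit, if_neg hc] at hn
      exact absurd hn (hu' _).not_ge

variable [MeasurableSpace H] [BorelSpace H] [TopologicalSpace.SeparableSpace H]
  [MeasurableSpace Ω]

theorem measurable_pursuit {θ : Ω → Ω} (hθ : Measurable θ) {T : Ω → H →L[𝕜] H}
    (hT : ∀ x, Measurable fun ω => T ω x) {ε : ℝ} {h : H} {u e : Ω → H}
    (hu : Measurable u) (he : Measurable e) (n : ℕ) :
    Measurable (pursuit θ T ε h u e n) := by
  induction n with
  | zero => exact he
  | succ n ih =>
    have hm : Measurable fun ω => T (θ^[n] ω) (pursuit θ T ε h u e n ω) :=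
      measurable_apply (A := fun ω => T (θ^[n] ω)) (fun x => (hT x).comp (hθ.iterate n)) ih
    exact Measurable.ite (measurableSet_le measurable_const hm.norm) (measurable_direction h hm)
      (hu.comp (hθ.iterate (n + 1)))

/-- A tower over whose base the cocycle is short connects prescribed directions. -/
theorem isConnectingTower_of_norm_cocycle_lt [CompleteSpace H] (hH : ¬ FiniteDimensional 𝕜 H)
    {μ : Measure Ω} {θ : Ω ≃ᵐ Ω} {T : Ω → H →L[𝕜] H} (hT : IsBddRandomCompact μ T) {ε : ℝ}
    (hε : 0 < ε) {N : ℕ} (hN : 1 ≤ N) {V : Set Ω} (hVm : MeasurableSet V) (hV0 : 0 < μ V)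
    (hV : ∀ ω ∈ V, ∀ i, 1 ≤ i → i ≤ N → θ^[i] ω ∉ V)
    (hVT : ∀ ω ∈ V, ‖cocycle θ T N ω‖ < ε ^ N) :
    IsConnectingTower μ θ T (3 * ε) N V := by
  classical
  refine ⟨hVm, hV0, fun i hi j hj hij => disjoint_image_iterate hV hi hj hij, fun e he => ?_⟩
  have : SecondCountableTopology H := UniformSpace.secondCountable_of_separable H
  obtain ⟨h, hh⟩ := exists_norm_eq_one hH
  obtain ⟨u, hum, hu⟩ := exists_measurable_unit (p := fun ω x => ‖T ω x‖ < ε) hh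
    (fun x => measurableSet_lt (hT.stronglyMeasurable x).norm measurable_const)
    (fun ω => isOpen_lt (T ω).continuous.norm continuous_const)
    (fun ω => exists_unit_norm_apply_lt hH (hT.compact ω) hε)
  set W : Set Ω := ⋃ i ∈ Finset.range N, θ^[i] '' V with hW
  have hWm : MeasurableSet W := measurableSet_tower θ N hVm
  let s : Ω → ℕ := hitTime θ.symm V
  have hsm : Measurable s := measurable_hitTime θ.symm.measurable hVm
  let F := pursuit θ T ε h u e
  have hF1 : ∀ n ω, ‖F n ω‖ = 1 := norm_pursuit hh (fun ω => (hu ω).1) he.norm_eq_one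
  have hFm : ∀ n, Measurable (F n) :=
    measurable_pursuit θ.measurable hT.stronglyMeasurable hum he.measurable
  let e' : Ω → H := fun ω => if ω ∈ W then F (s ω) (θ.symm^[s ω] ω) else e ω
  have hback : Measurable fun ω => θ.symm^[s ω] ω :=
    measurable_index (F := fun n => θ.symm^[n]) (fun n => θ.symm.measurable.iterate n) hsm
      measurable_id
  have he'm : Measurable e' := Measurable.ite hWm (measurable_index hFm hsm hback) he.measurable
  have he'1 : ∀ ω, ‖e' ω‖ = 1 := fun ω => by
    simp only [e']
    split_ifs
    · exact hF1 _ _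
    · exact he.norm_eq_one _
  have he'V : ∀ τ ∈ V, ∀ i < N, e' (θ^[i] τ) = F i τ := fun τ hτ i hi => by
    simp only [e', s]
    rw [if_pos (mem_tower.mpr ⟨i, hi, τ, hτ, rfl⟩), hitTime_symm_iterate hV hτ hi.le,
      iterate_symm_iterate]
  have he'N : ∀ τ ∈ V, e' (θ^[N] τ) = e (θ^[N] τ) := fun τ hτ => by
    simp only [e']
    refine if_neg fun hmem => ?_
    obtain ⟨i, hi, τ', hτ', hi'⟩ := mem_tower.mp hmem
    exact Set.disjoint_left.mp (disjoint_image_iterate hV hi.le le_rfl hi.ne)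
      ⟨τ', hτ', hi'⟩ ⟨τ, hτ, rfl⟩
  have hTe : Measurable fun ω => T ω (e' ω) := measurable_apply hT.stronglyMeasurable he'm
  let b : Ω → ℝ := fun ω => if ε ≤ ‖T ω (e' ω)‖ then ‖T ω (e' ω)‖ else ε
  have hbm : Measurable b :=
    Measurable.ite (measurableSet_le measurable_const hTe.norm) hTe.norm measurable_const
  have hbε : ∀ ω, ε ≤ b ω := fun ω => by
    simp only [b]
    split_ifs with h1
    · exact h1
    · exact le_rfl
  -- The defect of invariance: adding the rank-one operator `d ⊗ e'` to `T` sends `e'` exactly to `b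
  -- • e' ∘ θ`.
  let d : Ω → H := fun ω => (b ω : 𝕜) • e' (θ ω) - T ω (e' ω)
  have hbm' : Measurable fun ω => (b ω : 𝕜) := RCLike.measurable_ofReal.comp hbm
  have hdm : Measurable d := (hbm'.smul (he'm.comp θ.measurable)).sub hTe
  have hd : ∀ ω ∈ W, ‖d ω‖ ≤ 3 * ε := by
    intro ω hω
    obtain ⟨i, hi, τ, hτ, rfl⟩ := mem_tower.mp hω
    simp only [d, b]
    rw [← Function.iterate_succ_apply' θ]
    split_ifs with h1
    · have h2 : e' (θ^[i + 1] τ) = direction 𝕜 h (T (θ^[i] τ) (e' (θ^[i] τ))) := by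
        rw [he'V τ hτ i hi] at h1 ⊢
        rcases Nat.lt_or_ge (i + 1) N with hlt | hge
        · rw [he'V τ hτ _ hlt]
          simp only [F]
          rw [pursuit]
          exact if_pos h1
        -- At the top level the target is prescribed. A long image here would give `‖T^N‖ ≥ ε ^ N`,
        -- against the choice of `V`.
        · obtain rfl : N = i + 1 := by omega
          obtain ⟨c, hc1, hc2⟩ := pow_le_norm_cocycle_of_pursuit hε.le (fun ω => (hu ω).2) i τ h1
          have h3 := (cocycle θ T (i + 1) τ).le_opNorm (e τ)
          rw [hc2, norm_smul, norm_direction hh, he.norm_eq_one] at h3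
          linarith [hVT τ hτ]
      rw [h2, norm_smul_direction, sub_self, norm_zero]
      positivity
    · refine (norm_sub_le _ _).trans ?_
      rw [norm_smul, RCLike.norm_ofReal, he'1, abs_of_pos hε]
      linarith
  refine ⟨fun ω => T ω + (if ω ∈ W then (1 : 𝕜) else 0) •
      InnerProductSpace.rankOne 𝕜 (d ω) (e' ω), fun ω => (b ω : 𝕜), e', ?_, hbm', ⟨he'm, he'1⟩,
    ?_, ?_, ?_, ?_, ?_⟩
  · refine hT.of_norm_sub_le (C := 3 * ε)
      (fun ω => (hT.compact ω).add ((isCompactOperator_rankOne _ _).smul _))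
      (measurable_add_smul_rankOne hT.stronglyMeasurable
        (Measurable.ite hWm measurable_const measurable_const) hdm he'm)
      (ae_of_all _ fun ω => ?_)
    rw [add_sub_cancel_left]
    split_ifs with hω
    · rw [one_smul, InnerProductSpace.norm_rankOne, he'1, mul_one]
      exact hd ω hω
    · rw [zero_smul, norm_zero]
      positivity
  · rintro ω (hω | ⟨τ, hτ, rfl⟩)
    · exact he'V ω hω 0 hN
    · exact he'N τ hτ
  · intro ω _
    rw [RCLike.norm_ofReal, abs_of_pos (hε.trans_le (hbε ω))]
    linarith [hbε ω]
  · intro ω hω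
    simp [hω]
  · intro ω hω
    rw [add_sub_cancel_left, if_pos hω, one_smul, InnerProductSpace.norm_rankOne, he'1, mul_one]
    exact hd ω hω
  · intro ω hω i hi
    have hmem : θ^[i] ω ∈ W := mem_tower.mpr ⟨i, hi, ω, hω, rfl⟩
    simp only [if_pos hmem, one_smul, add_apply, InnerProductSpace.rankOne_apply,
      inner_self_eq_norm_sq_to_K, he'1, d]
    rw [← Function.iterate_succ_apply' θ]
    simp

/-- The C*-identity gives `‖T^n‖ ^ 2 = ‖A n ^ (2 * n)‖ ≤ ‖A n‖ ^ (2 * n)`, and eventually `‖A n‖ <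
ε`. -/
theorem ae_eventually_norm_cocycle_lt [CompleteSpace H] {μ : Measure Ω} {θ : Ω → Ω}
    {T : Ω → H →L[𝕜] H} (hT : IsNull μ θ T) {ε : ℝ} (hε : 0 < ε) :
    ∀ᵐ ω ∂μ, ∃ n₀ : ℕ, ∀ n, n₀ ≤ n → ‖cocycle θ T n ω‖ < ε ^ n := by
  filter_upwards [hT.limit_eq_zero] with ω ⟨A, hA, hlim⟩
  have hev : ∀ᶠ n in atTop, ‖A n‖ < ε := by
    have := hlim.norm
    rw [norm_zero] at this
    exact this.eventually_lt_const hε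
  obtain ⟨n₀, hn₀⟩ := eventually_atTop.mp hev
  refine ⟨n₀ + 1, fun n hn => ?_⟩
  have h1 := (hA n (by omega)).2
  have h2 : ‖cocycle θ T n ω‖ * ‖cocycle θ T n ω‖ ≤ ‖A n‖ ^ (2 * n) := by
    rw [← ContinuousLinearMap.norm_adjoint_comp_self, ← h1]
    exact norm_pow_le' _ (by omega)
  have h3 : ‖A n‖ ^ (2 * n) < ε ^ (2 * n) :=
    pow_lt_pow_left₀ (hn₀ n (by omega)) (norm_nonneg _) (by omega)
  have h4 : ‖cocycle θ T n ω‖ ^ 2 < (ε ^ n) ^ 2 := by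
    rw [← pow_mul, mul_comm n 2, sq]
    exact h2.trans_lt h3
  exact lt_of_pow_lt_pow_left₀ 2 (by positivity) h4

theorem exists_isConnectingTower [CompleteSpace H] (hH : ¬ FiniteDimensional 𝕜 H)
    {μ : Measure Ω} [IsProbabilityMeasure μ] (hμ : NonAtomic μ) {θ : Ω ≃ᵐ Ω} (hθ : Ergodic θ μ)
    {T : Ω → H →L[𝕜] H} (hT : IsNull μ θ T) {ε : ℝ} (hε : 0 < ε) :
    ∃ Nstar : ℕ, 1 ≤ Nstar ∧
      ∀ N, Nstar ≤ N → ∃ V, IsConnectingTower μ θ T (3 * ε) N V := by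
  have hm : ∀ n, MeasurableSet {ω | ‖cocycle θ T n ω‖ < ε ^ n} := fun n =>
    measurableSet_lt (measurable_opNorm (measurable_cocycle θ.measurable hT.mem.stronglyMeasurable n))
      measurable_const
  -- These sets cover almost all of `Ω` as `n₀` varies, so one of them is not null; the same `n₀`
  -- then serves every larger `N`.
  obtain ⟨n₀, hn₀⟩ : ∃ n₀ : ℕ, μ {ω | ∀ n, n₀ ≤ n → ‖cocycle θ T n ω‖ < ε ^ n} ≠ 0 := by
    by_contra! hcon
    have h1 : μ (⋃ n₀ : ℕ, {ω | ∀ n, n₀ ≤ n → ‖cocycle θ T n ω‖ < ε ^ n}) = 0 :=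
      measure_iUnion_null hcon
    have h2 : ∀ᵐ ω ∂μ, False := by
      filter_upwards [ae_eventually_norm_cocycle_lt hT hε, measure_eq_zero_iff_ae_notMem.mp h1]
        with ω h3 h4
      exact h4 (Set.mem_iUnion.mpr h3)
    have h3 : (ae μ).NeBot := inferInstance
    exact h2.exists.elim fun _ h => h
  refine ⟨n₀ + 1, by omega, fun N hN => ?_⟩
  have hpos : 0 < μ {ω | ‖cocycle θ T N ω‖ < ε ^ N} :=
    (pos_iff_ne_zero.mpr hn₀).trans_le (measure_mono fun ω hω => hω N (by omega))
  obtain ⟨V, hVA, hVm, hV0, hV⟩ := exists_subset_no_return hμ hθ (hm N) hpos N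
  exact ⟨V, isConnectingTower_of_norm_cocycle_lt hH hT.mem hε (by omega) hVm hV0 hV
    fun ω hω => hVA hω⟩

end Connecting

/-! ### Perturbations inside a block and at its start. -/

section Fields

set_option linter.unusedSectionVars false

variable {𝕜 H Ω : Type*} [RCLike 𝕜] [NormedAddCommGroup H] [InnerProductSpace 𝕜 H]

/-- The products of `m` consecutive operators `T(θ^i ω) ± ε h ⊗ h`, where the signs, chosen from
the left to the right, keep the norm at least `ε ^ m`. -/
noncomputable def tiltedBlock (θ : Ω → Ω) (T : Ω → H →L[𝕜] H) (ε : ℝ) (h : H) :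
    ℕ → Ω → H →L[𝕜] H
  | 0, _ => ContinuousLinearMap.id 𝕜 H
  | m + 1, ω => (tiltedBlock θ T ε h m (θ ω)).comp
      (T ω + (growSign 𝕜 (tiltedBlock θ T ε h m (θ ω) (T ω h))
        ((ε : 𝕜) • tiltedBlock θ T ε h m (θ ω) h) * (ε : 𝕜)) • InnerProductSpace.rankOne 𝕜 h h)

/-- The first factor of a tilted block of length `m + 1`. -/
noncomputable def tilted (θ : Ω → Ω) (T : Ω → H →L[𝕜] H) (ε : ℝ) (h : H) (m : ℕ) (ω : Ω) :
    H →L[𝕜] H :=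
  T ω + (growSign 𝕜 (tiltedBlock θ T ε h m (θ ω) (T ω h))
    ((ε : 𝕜) • tiltedBlock θ T ε h m (θ ω) h) * (ε : 𝕜)) • InnerProductSpace.rankOne 𝕜 h h

theorem tiltedBlock_succ (θ : Ω → Ω) (T : Ω → H →L[𝕜] H) (ε : ℝ) (h : H) (m : ℕ) (ω : Ω) :
    tiltedBlock θ T ε h (m + 1) ω
      = (tiltedBlock θ T ε h m (θ ω)).comp (tilted θ T ε h m ω) := rfl

theorem norm_tilted_sub_le {θ : Ω → Ω} {T : Ω → H →L[𝕜] H} {ε : ℝ} (hε : 0 ≤ ε) {h : H}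
    (hh : ‖h‖ = 1) (m : ℕ) (ω : Ω) : ‖tilted θ T ε h m ω - T ω‖ ≤ ε := by
  rw [tilted, add_sub_cancel_left, norm_smul, norm_mul, norm_growSign, RCLike.norm_ofReal,
    InnerProductSpace.norm_rankOne, hh, abs_of_nonneg hε]
  simp

/-- The later factors, with product `Q`, are fixed first. The sign then gives `‖Q (T h ± ε h)‖ ≥ ε
‖Q h‖`, one factor `ε` per step. -/
theorem pow_le_norm_tiltedBlock_apply {θ : Ω → Ω} {T : Ω → H →L[𝕜] H} {ε : ℝ} (hε : 0 ≤ ε) {h : H}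
    (hh : ‖h‖ = 1) (m : ℕ) (ω : Ω) : ε ^ m ≤ ‖tiltedBlock θ T ε h m ω h‖ := by
  induction m generalizing ω with
  | zero => simp [tiltedBlock, hh]
  | succ m ih =>
    have h1 := le_norm_add_growSign_smul (𝕜 := 𝕜) (tiltedBlock θ T ε h m (θ ω) (T ω h))
      ((ε : 𝕜) • tiltedBlock θ T ε h m (θ ω) h)
    rw [norm_smul, RCLike.norm_ofReal, abs_of_nonneg hε] at h1
    rw [tiltedBlock_succ, ContinuousLinearMap.comp_apply, tilted, add_apply, smul_apply,
      InnerProductSpace.rankOne_apply, inner_self_eq_norm_sq_to_K, hh, map_add, map_smul, map_smul]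
    simp only [RCLike.ofReal_one, one_pow, one_smul, mul_smul]
    refine le_trans ?_ h1
    rw [pow_succ, mul_comm]
    exact mul_le_mul_of_nonneg_left (ih _) hε

theorem pow_le_norm_tiltedBlock {θ : Ω → Ω} {T : Ω → H →L[𝕜] H} {ε : ℝ} (hε : 0 ≤ ε) {h : H}
    (hh : ‖h‖ = 1) (m : ℕ) (ω : Ω) : ε ^ m ≤ ‖tiltedBlock θ T ε h m ω‖ := by
  refine (pow_le_norm_tiltedBlock_apply (T := T) (θ := θ) hε hh m ω).trans ?_
  simpa [hh] using (tiltedBlock θ T ε h m ω).le_opNorm h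

theorem isCompactOperator_tilted {θ : Ω → Ω} {T : Ω → H →L[𝕜] H} {ε : ℝ} {h : H}
    (hT : ∀ ω, IsCompactOperator (T ω)) (m : ℕ) (ω : Ω) :
    IsCompactOperator (tilted θ T ε h m ω) :=
  (hT ω).add ((isCompactOperator_rankOne h h).smul _)

/-- A perturbation of the identity that moves `v` towards `u`, in such a way that the image under
`Q` does not become short. -/
noncomputable def kick (ε : ℝ) (Q : H →L[𝕜] H) (u v : H) : H →L[𝕜] H :=
  ContinuousLinearMap.id 𝕜 H +
    (growSign 𝕜 (Q v) (((2 * ε : ℝ) : 𝕜) • Q u) * ((2 * ε : ℝ) : 𝕜)) •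
      InnerProductSpace.rankOne 𝕜 u v

theorem norm_kick_sub_le {ε : ℝ} (hε : 0 ≤ ε) (Q : H →L[𝕜] H) {u v : H} (hu : ‖u‖ = 1)
    (hv : ‖v‖ = 1) : ‖kick ε Q u v - ContinuousLinearMap.id 𝕜 H‖ ≤ 2 * ε := by
  rw [kick, add_sub_cancel_left, norm_smul, norm_mul, norm_growSign, RCLike.norm_ofReal,
    InnerProductSpace.norm_rankOne, hu, hv, abs_of_nonneg (by positivity)]
  simp

theorem norm_kick_le {ε : ℝ} (hε : 0 ≤ ε) (Q : H →L[𝕜] H) {u v : H} (hu : ‖u‖ = 1)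
    (hv : ‖v‖ = 1) : ‖kick ε Q u v‖ ≤ 1 + 2 * ε := by
  have h1 : kick ε Q u v = ContinuousLinearMap.id 𝕜 H
      + (kick ε Q u v - ContinuousLinearMap.id 𝕜 H) := by abel
  rw [h1]
  exact (norm_add_le _ _).trans
    (add_le_add ContinuousLinearMap.norm_id_le (norm_kick_sub_le hε Q hu hv))

theorem le_norm_apply_kick {ε : ℝ} (hε : 0 ≤ ε) (Q : H →L[𝕜] H) {u v : H} (hv : ‖v‖ = 1) :
    2 * ε * ‖Q u‖ ≤ ‖Q (kick ε Q u v v)‖ := by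
  have h1 := le_norm_add_growSign_smul (𝕜 := 𝕜) (Q v) (((2 * ε : ℝ) : 𝕜) • Q u)
  rw [norm_smul, RCLike.norm_ofReal, abs_of_nonneg (by positivity)] at h1
  rw [kick, add_apply, smul_apply, InnerProductSpace.rankOne_apply, inner_self_eq_norm_sq_to_K, hv,
    map_add, map_smul, map_smul]
  simpa only [RCLike.ofReal_one, one_pow, one_smul, mul_smul, ContinuousLinearMap.id_apply] using h1

variable [MeasurableSpace H] [BorelSpace H] [TopologicalSpace.SeparableSpace H]
  [MeasurableSpace Ω]

theorem measurable_tilted_and_tiltedBlock {θ : Ω → Ω} (hθ : Measurable θ) {T : Ω → H →L[𝕜] H}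
    (hT : ∀ x, Measurable fun ω => T ω x) (ε : ℝ) (h : H) (m : ℕ) :
    (∀ x, Measurable fun ω => tilted θ T ε h m ω x) ∧
      ∀ x, Measurable fun ω => tiltedBlock θ T ε h m ω x := by
  have key : ∀ m, (∀ x, Measurable fun ω => tiltedBlock θ T ε h m ω x) →
      ∀ x, Measurable fun ω => tilted θ T ε h m ω x := fun m hm => by
    have hm' : ∀ x, Measurable fun ω => tiltedBlock θ T ε h m (θ ω) x := fun x => (hm x).comp hθ
    exact measurable_add_smul_rankOne hT ((measurable_growSign (measurable_apply hm' (hT h))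
      ((hm' h).const_smul _)).mul_const _) measurable_const measurable_const
  have hblock : ∀ m x, Measurable fun ω => tiltedBlock θ T ε h m ω x := fun m => by
    induction m with
    | zero => exact fun x => measurable_const
    | succ m ih =>
      exact fun x => measurable_apply (A := fun ω => tiltedBlock θ T ε h m (θ ω))
        (fun x => (ih x).comp hθ) (key m ih x)
  exact ⟨key m (hblock m), hblock m⟩

theorem measurable_kick (ε : ℝ) {Q : Ω → H →L[𝕜] H} (hQ : ∀ x, Measurable fun ω => Q ω x)
    {u v : Ω → H} (hu : Measurable u) (hv : Measurable v) (x : H) :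
    Measurable fun ω => kick ε (Q ω) (u ω) (v ω) x := by
  refine measurable_add_smul_rankOne (A := fun _ => ContinuousLinearMap.id 𝕜 H)
    (fun _ => measurable_const) ((measurable_growSign (measurable_apply hQ hv) ?_).mul_const _)
    hu hv x
  exact (measurable_apply hQ hu).const_smul _

theorem exists_measurable_almost_maximizer {h : H} (hh : ‖h‖ = 1) {Q : Ω → H →L[𝕜] H}
    (hQ : ∀ x, Measurable fun ω => Q ω x) :
    ∃ u : Ω → H, Measurable u ∧ ∀ ω, ‖u ω‖ = 1 ∧ 3 / 4 * ‖Q ω‖ ≤ ‖Q ω (u ω)‖ := by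
  have hn := measurable_opNorm hQ
  obtain ⟨u, hum, hu⟩ := exists_measurable_unit
    (p := fun ω x => ‖Q ω‖ = 0 ∨ 3 / 4 * ‖Q ω‖ < ‖Q ω x‖) hh
    (fun x => (measurableSet_eq_fun hn measurable_const).union
      (measurableSet_lt (hn.const_mul _) (hQ x).norm))
    (fun ω => isOpen_const.union (isOpen_lt continuous_const (Q ω).continuous.norm))
    (fun ω => by
      by_cases h0 : Q ω = 0
      · exact ⟨h, hh, Or.inl (by rw [h0, norm_zero])⟩
      · obtain ⟨v, hv, hv'⟩ := exists_unit_lt_norm_apply hh (Q ω) (r := 3 / 4) (by norm_num)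
          (by norm_num) h0
        exact ⟨v, hv, Or.inr hv'⟩)
  refine ⟨u, hum, fun ω => ⟨(hu ω).1, ?_⟩⟩
  rcases (hu ω).2 with h0 | h1
  · rw [h0, mul_zero]
    exact norm_nonneg _
  · exact h1.le

end Fields

/-! ### Combinatorics of gaps and blocks along an orbit. -/

section Orbits

variable {Ω : Type*} [MeasurableSpace Ω]

/-- `V` is visited in the future and in the past by all points of the invariant set `G`, and its
points do not return within time `K + N`. -/
structure IsSpreadBase (θ : Ω ≃ᵐ Ω) (N K : ℕ) (V G : Set Ω) : Prop where
  pos : 1 ≤ N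
  invariant : ∀ ω, θ ω ∈ G ↔ ω ∈ G
  forward : ∀ ω ∈ G, ∃ n, θ^[n] ω ∈ V
  backward : ∀ ω ∈ G, ∃ n, θ.symm^[n] ω ∈ V
  noReturn : ∀ ω ∈ V, ∀ i, 1 ≤ i → i ≤ K + N → θ^[i] ω ∉ V

/-- The tower of height `N` over `V`. -/
def tower (θ : Ω ≃ᵐ Ω) (N : ℕ) (V : Set Ω) : Set Ω := ⋃ i ∈ Finset.range N, θ^[i] '' V

/-- The time since the last exit from the tower. -/
noncomputable def exitAge (θ : Ω ≃ᵐ Ω) (N : ℕ) (V : Set Ω) : Ω → ℕ :=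
  hitTime θ.symm (θ^[N] '' V)

/-- The time left in the current block, where the gaps between the visits to the tower are cut
into blocks of length `N` and a last one of length at most `N`. -/
noncomputable def blockLeft (θ : Ω ≃ᵐ Ω) (N : ℕ) (V : Set Ω) (ω : Ω) : ℕ :=
  min (N - exitAge θ N V ω % N) (hitTime θ V ω)

namespace IsSpreadBase

variable {θ : Ω ≃ᵐ Ω} {N K : ℕ} {V G : Set Ω}

theorem iterate_mem (hs : IsSpreadBase θ N K V G) {ω : Ω} (n : ℕ) : θ^[n] ω ∈ G ↔ ω ∈ G := by
  induction n with
  | zero => rfl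
  | succ n ih => rw [Function.iterate_succ_apply', hs.invariant, ih]

theorem symm_mem (hs : IsSpreadBase θ N K V G) {ω : Ω} : θ.symm ω ∈ G ↔ ω ∈ G := by
  rw [← hs.invariant, θ.apply_symm_apply]

theorem notMem_base (hs : IsSpreadBase θ N K V G) {ω : Ω} (hω : ω ∉ tower θ N V) : ω ∉ V :=
  fun h => hω (mem_tower.mpr ⟨0, hs.pos, ω, h, rfl⟩)

theorem exists_exit (hs : IsSpreadBase θ N K V G) {ω : Ω} (hω : ω ∈ G) :
    ∃ n, θ.symm^[n] ω ∈ θ^[N] '' V := by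
  obtain ⟨n, hn⟩ := hs.backward (θ.symm^[N] ω)
    ((hs.iterate_mem N).mp (by rwa [iterate_iterate_symm]))
  refine ⟨n, ⟨_, hn, ?_⟩⟩
  rw [← Function.iterate_add_apply, add_comm n N, Function.iterate_add_apply, iterate_iterate_symm]

theorem exit_notMem_tower (hs : IsSpreadBase θ N K V G) {τ : Ω} (hτ : τ ∈ V) :
    θ^[N] τ ∉ tower θ N V := fun hmem => by
  obtain ⟨i, hi, τ', hτ', hi'⟩ := mem_tower.mp hmem
  exact Set.disjoint_left.mp (disjoint_image_iterate hs.noReturn (by omega) (by omega) hi.ne)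
    ⟨τ', hτ', hi'⟩ ⟨τ, hτ, rfl⟩

theorem exitAge_exit {τ : Ω} (hτ : τ ∈ V) : exitAge θ N V (θ^[N] τ) = 0 :=
  hitTime_eq_zero ⟨τ, hτ, rfl⟩

theorem lt_hitTime_exit (hs : IsSpreadBase θ N K V G) {τ : Ω} (hτ : τ ∈ V) (hG : τ ∈ G) :
    K < hitTime θ V (θ^[N] τ) := by
  by_contra! hle
  have h1 := hitTime_mem (hs.forward _ ((hs.iterate_mem N).mpr hG))
  rw [← Function.iterate_add_apply] at h1
  exact hs.noReturn τ hτ _ (by have := hs.pos; omega) (by omega) h1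

theorem exitAge_succ (hs : IsSpreadBase θ N K V G) {ω : Ω} (hG : ω ∈ G)
    (hω : ω ∉ tower θ N V) : exitAge θ N V (θ ω) = exitAge θ N V ω + 1 := by
  have h1 : θ ω ∉ θ^[N] '' V := by
    rintro ⟨τ, hτ, h⟩
    obtain ⟨n, hn⟩ := Nat.exists_eq_add_of_le' hs.pos
    rw [hn, Function.iterate_succ_apply'] at h
    exact hω (mem_tower.mpr ⟨n, by omega, τ, hτ, θ.injective h⟩)
  have := hitTime_succ h1 (hs.exists_exit ((hs.symm_mem).mpr ((hs.invariant ω).mpr hG)))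
  rwa [θ.symm_apply_apply] at this

theorem hitTime_succ' (hs : IsSpreadBase θ N K V G) {ω : Ω} (hG : ω ∈ G)
    (hω : ω ∉ tower θ N V) : hitTime θ V ω = hitTime θ V (θ ω) + 1 :=
  hitTime_succ (hs.notMem_base hω) (hs.forward _ ((hs.invariant ω).mpr hG))

theorem mem_base_of_mem_tower {ω : Ω}
    (hω : ω ∉ tower θ N V) (h : θ ω ∈ tower θ N V) : θ ω ∈ V := by
  obtain ⟨i, hi, τ, hτ, hiω⟩ := mem_tower.mp h
  cases i with
  | zero => rw [← hiω]; exact hτ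
  | succ i =>
    rw [Function.iterate_succ_apply'] at hiω
    exact absurd (mem_tower.mpr ⟨i, by omega, τ, hτ, θ.injective hiω⟩) hω

theorem symm_notMem_tower {ω : Ω} (hω : ω ∉ tower θ N V)
    (h : exitAge θ N V ω ≠ 0) : θ.symm ω ∉ tower θ N V := fun hmem => by
  obtain ⟨i, hi, τ, hτ, hiω⟩ := mem_tower.mp hmem
  have h1 : θ^[i + 1] τ = ω := by
    rw [Function.iterate_succ_apply', hiω, θ.apply_symm_apply]
  rcases Nat.lt_or_ge (i + 1) N with hlt | hge
  · exact hω (mem_tower.mpr ⟨i + 1, hlt, τ, hτ, h1⟩)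
  · obtain rfl : N = i + 1 := by omega
    rw [← h1] at h
    exact h (exitAge_exit hτ)

/-- Inside a gap two clocks run: the age since the exit counts up and the time to the next entry
counts down. Blocks are read off from both. -/
theorem gap_iterate (hs : IsSpreadBase θ N K V G) {ω : Ω} (hG : ω ∈ G) (hω : ω ∉ tower θ N V)
    (j : ℕ) (hj : j < hitTime θ V ω) :
    θ^[j] ω ∉ tower θ N V ∧ exitAge θ N V (θ^[j] ω) = exitAge θ N V ω + j ∧
      hitTime θ V (θ^[j] ω) = hitTime θ V ω - j := by
  induction j with
  | zero => exact ⟨hω, rfl, rfl⟩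
  | succ j ih =>
    obtain ⟨h1, h2, h3⟩ := ih (by omega)
    have hGj := (hs.iterate_mem (ω := ω) j).mpr hG
    rw [Function.iterate_succ_apply']
    have h4 := hs.hitTime_succ' hGj h1
    refine ⟨fun hmem => ?_, ?_, ?_⟩
    · have := hitTime_eq_zero (f := θ) (mem_base_of_mem_tower h1 hmem)
      omega
    · rw [hs.exitAge_succ hGj h1, h2, add_assoc]
    · omega

theorem blockLeft_pos (hs : IsSpreadBase θ N K V G) {ω : Ω} (hG : ω ∈ G)
    (hω : ω ∉ tower θ N V) : 1 ≤ blockLeft θ N V ω := by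
  have h1 := hs.hitTime_succ' hG hω
  have h2 := Nat.mod_lt (exitAge θ N V ω) hs.pos
  exact le_min (by omega) (by omega)

theorem blockLeft_succ (hs : IsSpreadBase θ N K V G) {ω : Ω} (hG : ω ∈ G)
    (hω : ω ∉ tower θ N V) {m : ℕ} (hm : blockLeft θ N V ω = m + 2) :
    θ ω ∉ tower θ N V ∧ exitAge θ N V (θ ω) % N = exitAge θ N V ω % N + 1 ∧
      blockLeft θ N V (θ ω) = m + 1 := by
  have h0 : blockLeft θ N V ω ≤ N - exitAge θ N V ω % N := min_le_left _ _
  have h0' : blockLeft θ N V ω ≤ hitTime θ V ω := min_le_right _ _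
  obtain ⟨h1, h2, h3⟩ := hs.gap_iterate hG hω 1 (by omega)
  have h4 : exitAge θ N V (θ ω) % N = exitAge θ N V ω % N + 1 := by
    rw [show exitAge θ N V (θ ω) = exitAge θ N V ω + 1 from h2, ← Nat.mod_add_mod,
      Nat.mod_eq_of_lt (by omega)]
  refine ⟨h1, h4, ?_⟩
  have h3' : hitTime θ V (θ ω) = hitTime θ V ω - 1 := h3
  unfold blockLeft at hm ⊢
  omega

/-- The points where a block starts or the tower is entered. -/
def IsStart (θ : Ω ≃ᵐ Ω) (N : ℕ) (V : Set Ω) (ω : Ω) : Prop :=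
  ω ∈ V ∨ ω ∉ tower θ N V ∧ exitAge θ N V ω % N = 0

theorem isStart_after_block (hs : IsSpreadBase θ N K V G) {ω : Ω} (hG : ω ∈ G)
    (hω : ω ∉ tower θ N V) : IsStart θ N V (θ^[blockLeft θ N V ω] ω) := by
  have h0 : blockLeft θ N V ω ≤ hitTime θ V ω := min_le_right _ _
  rcases h0.eq_or_lt with h | h
  · left
    rw [h]
    exact hitTime_mem (hs.forward ω hG)
  · right
    obtain ⟨h1, h2, h3⟩ := hs.gap_iterate hG hω _ h
    refine ⟨h1, ?_⟩
    have h4 := Nat.mod_lt (exitAge θ N V ω) hs.pos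
    have h5 : exitAge θ N V ω % N + blockLeft θ N V ω = N := by
      unfold blockLeft at h ⊢
      omega
    rw [h2, ← Nat.mod_add_mod, h5, Nat.mod_self]

theorem blockLeft_start {ω : Ω} (h : exitAge θ N V ω % N = 0) :
    blockLeft θ N V ω = min N (hitTime θ V ω) := by
  rw [blockLeft, h, Nat.sub_zero]

end IsSpreadBase

end Orbits

/-! ### Growth of the invariant direction compared with the norm of the cocycle. -/

section Growth

variable {𝕜 H Ω : Type*} [RCLike 𝕜] [NormedAddCommGroup H] [InnerProductSpace 𝕜 H]
  [MeasurableSpace Ω]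

/-- A cocycle with an invariant direction `e` that grows at least by `ε` in each step inside
the tower and follows, up to a perturbation at the first step, the products `Q` in each block. -/
structure IsBlockField (θ : Ω ≃ᵐ Ω) (N K : ℕ) (V G : Set Ω) (ε M : ℝ)
    (B Q : ℕ → Ω → H →L[𝕜] H) (S : Ω → H →L[𝕜] H) (e : Ω → H) : Prop where
  base : IsSpreadBase θ N K V G
  eps_pos : 0 < ε
  eps_lt : ε < 1 / 6
  one_le : 1 ≤ M
  prod_zero : ∀ ω, Q 0 ω = ContinuousLinearMap.id 𝕜 H
  prod_succ : ∀ m ω, Q (m + 1) ω = (Q m (θ ω)).comp (B m ω)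
  le_prod : ∀ m ω, ε ^ m ≤ ‖Q m ω‖
  norm_le : ∀ ω ∈ G, ‖S ω‖ ≤ M
  unit : ∀ ω, ‖e ω‖ = 1
  invariant : ∀ ω ∈ G, ∃ c : 𝕜, S ω (e ω) = c • e (θ ω)
  growth : ∀ ω ∈ G, ω ∈ tower θ N V → ε ≤ ‖S ω (e ω)‖
  inside : ∀ ω ∈ G, ω ∉ tower θ N V → exitAge θ N V ω % N ≠ 0 →
    S ω = B (blockLeft θ N V ω - 1) ω
  start : ∀ ω ∈ G, ω ∉ tower θ N V → exitAge θ N V ω % N = 0 →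
    ∃ R : H →L[𝕜] H, S ω = (B (blockLeft θ N V ω - 1) ω).comp R ∧ ‖R‖ ≤ 1 + 2 * ε ∧
      3 / 2 * ε * ‖Q (blockLeft θ N V ω) ω‖ ≤ ‖Q (blockLeft θ N V ω) ω (R (e ω))‖

/-- Over `n` steps from `ω`, the growth of the direction `e` is at least `ε ^ a / M ^ b` times
the norm of the cocycle. -/
def HasRatio (θ : Ω → Ω) (S : Ω → H →L[𝕜] H) (e : Ω → H) (ε M : ℝ) (a b n : ℕ) (ω : Ω) : Prop :=
  ε ^ a / M ^ b * ‖cocycle θ S n ω‖ ≤ ‖cocycle θ S n ω (e ω)‖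

namespace IsBlockField

open IsSpreadBase

variable {θ : Ω ≃ᵐ Ω} {N K : ℕ} {V G : Set Ω} {ε M : ℝ} {B Q : ℕ → Ω → H →L[𝕜] H}
  {S : Ω → H →L[𝕜] H} {e : Ω → H}

theorem norm_cocycle_le (hf : IsBlockField θ N K V G ε M B Q S e) {ω : Ω} (hG : ω ∈ G) (n : ℕ) :
    ‖cocycle θ S n ω‖ ≤ M ^ n := by
  have hM := hf.one_le
  induction n with
  | zero => simpa [cocycle] using ContinuousLinearMap.norm_id_le
  | succ n ih =>
    rw [pow_succ, mul_comm]
    exact (ContinuousLinearMap.opNorm_comp_le _ _).trans (mul_le_mul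
      (hf.norm_le _ ((hf.base.iterate_mem n).mpr hG)) ih (norm_nonneg _) (by positivity))

theorem norm_cocycle_apply_le (hf : IsBlockField θ N K V G ε M B Q S e) {ω : Ω} (hG : ω ∈ G)
    (n : ℕ) : ‖cocycle θ S n ω (e ω)‖ ≤ M ^ n := by
  have h1 := (cocycle θ S n ω).le_opNorm (e ω)
  rw [hf.unit, mul_one] at h1
  exact h1.trans (hf.norm_cocycle_le hG n)

theorem exists_cocycle_apply_eq (hf : IsBlockField θ N K V G ε M B Q S e) {ω : Ω} (hG : ω ∈ G)
    (n : ℕ) : ∃ c : 𝕜, cocycle θ S n ω (e ω) = c • e (θ^[n] ω) := by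
  induction n with
  | zero => exact ⟨1, by simp [cocycle]⟩
  | succ n ih =>
    obtain ⟨c, hc⟩ := ih
    obtain ⟨d, hd⟩ := hf.invariant _ ((hf.base.iterate_mem n).mpr hG)
    refine ⟨c * d, ?_⟩
    change S (θ^[n] ω) (cocycle θ S n ω (e ω)) = _
    rw [hc, map_smul, hd, smul_smul, ← Function.iterate_succ_apply' θ]

theorem norm_cocycle_add_apply (hf : IsBlockField θ N K V G ε M B Q S e) {ω : Ω} (hG : ω ∈ G)
    (a b : ℕ) : ‖cocycle θ S (a + b) ω (e ω)‖
      = ‖cocycle θ S a ω (e ω)‖ * ‖cocycle θ S b (θ^[a] ω) (e (θ^[a] ω))‖ := by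
  obtain ⟨c, hc⟩ := hf.exists_cocycle_apply_eq hG a
  rw [cocycle_add, ContinuousLinearMap.comp_apply, hc, map_smul, norm_smul, norm_smul, hf.unit,
    mul_one]

theorem hasRatio_mono (hf : IsBlockField θ N K V G ε M B Q S e) {a b a' b' n : ℕ} {ω : Ω}
    (h : HasRatio θ S e ε M a b n ω) (ha : a ≤ a') (hb : b ≤ b') :
    HasRatio θ S e ε M a' b' n ω := by
  refine le_trans (mul_le_mul_of_nonneg_right ?_ (norm_nonneg _)) h
  have hM := hf.one_le
  have hε := hf.eps_pos
  have h1 : ε ^ a' ≤ ε ^ a := pow_le_pow_of_le_one hε.le (by linarith [hf.eps_lt]) ha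
  have h2 : M ^ b ≤ M ^ b' := pow_le_pow_right₀ hM hb
  gcongr

/-- Operator norms are submultiplicative, while growth along an invariant direction is exactly
multiplicative. -/
theorem hasRatio_add (hf : IsBlockField θ N K V G ε M B Q S e) {a b a' b' n n' : ℕ} {ω : Ω}
    (hG : ω ∈ G) (h : HasRatio θ S e ε M a b n ω) (h' : HasRatio θ S e ε M a' b' n' (θ^[n] ω)) :
    HasRatio θ S e ε M (a + a') (b + b') (n + n') ω := by
  have hM : 0 < M := by linarith [hf.one_le]
  have hε := hf.eps_pos
  unfold HasRatio at *
  rw [hf.norm_cocycle_add_apply hG, cocycle_add]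
  calc ε ^ (a + a') / M ^ (b + b') *
        ‖(cocycle θ S n' (θ^[n] ω)).comp (cocycle θ S n ω)‖
      ≤ ε ^ (a + a') / M ^ (b + b') * (‖cocycle θ S n' (θ^[n] ω)‖ * ‖cocycle θ S n ω‖) := by
        gcongr
        exact ContinuousLinearMap.opNorm_comp_le _ _
    _ = (ε ^ a / M ^ b * ‖cocycle θ S n ω‖) *
          (ε ^ a' / M ^ b' * ‖cocycle θ S n' (θ^[n] ω)‖) := by
        rw [pow_add, pow_add, mul_div_mul_comm]; ring
    _ ≤ _ := by gcongr

theorem hasRatio_zero (hf : IsBlockField θ N K V G ε M B Q S e) (a b : ℕ) (ω : Ω) :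
    HasRatio θ S e ε M a b 0 ω := by
  refine hf.hasRatio_mono (a := 0) (b := 0) ?_ (Nat.zero_le _) (Nat.zero_le _)
  simpa [HasRatio, cocycle, hf.unit] using ContinuousLinearMap.norm_id_le

/-- Absolute growth suffices, because the norm of the cocycle is at most `M ^ n`; the unused `b - n`
powers of `M` are left for the growth estimate. -/
theorem hasRatio_of_le (hf : IsBlockField θ N K V G ε M B Q S e) {a b n : ℕ} {ω : Ω}
    (hG : ω ∈ G) (hn : n ≤ b) (h : ε ^ a ≤ M ^ (b - n) * ‖cocycle θ S n ω (e ω)‖) :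
    HasRatio θ S e ε M a b n ω := by
  have hM : 0 < M := by linarith [hf.one_le]
  have hε := hf.eps_pos
  unfold HasRatio
  rw [div_mul_eq_mul_div, div_le_iff₀ (by positivity)]
  calc ε ^ a * ‖cocycle θ S n ω‖ ≤ (M ^ (b - n) * ‖cocycle θ S n ω (e ω)‖) * M ^ n := by
        gcongr
        exact hf.norm_cocycle_le hG n
    _ = ‖cocycle θ S n ω (e ω)‖ * M ^ b := by
        rw [← Nat.sub_add_cancel hn, pow_add, Nat.add_sub_cancel]; ring

/-- Past its start a block has no kick, and its factors are indexed by the time left, so the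
recursion for `Q` peels them off in orbit order. -/
theorem cocycle_inside_block (hf : IsBlockField θ N K V G ε M B Q S e) (m : ℕ) {ω : Ω}
    (hG : ω ∈ G) (hω : ω ∉ tower θ N V) (h0 : exitAge θ N V ω % N ≠ 0)
    (hm : blockLeft θ N V ω = m + 1) : cocycle θ S (m + 1) ω = Q (m + 1) ω := by
  induction m generalizing ω with
  | zero =>
    rw [cocycle_one, hf.inside ω hG hω h0, hm, hf.prod_succ, hf.prod_zero]
    rfl
  | succ m ih =>
    obtain ⟨h1, h2, h3⟩ := hf.base.blockLeft_succ hG hω hm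
    rw [cocycle_succ', ih ((hf.base.invariant ω).mpr hG) h1 (by omega) h3, hf.inside ω hG hω h0, hm,
      hf.prod_succ (m + 1)]
    rfl

theorem exists_cocycle_block_eq (hf : IsBlockField θ N K V G ε M B Q S e) {ω : Ω}
    (hG : ω ∈ G) (hω : ω ∉ tower θ N V) (h0 : exitAge θ N V ω % N = 0) :
    ∃ R : H →L[𝕜] H, cocycle θ S (blockLeft θ N V ω) ω = (Q (blockLeft θ N V ω) ω).comp R ∧
      ‖R‖ ≤ 1 + 2 * ε ∧
      3 / 2 * ε * ‖Q (blockLeft θ N V ω) ω‖ ≤ ‖Q (blockLeft θ N V ω) ω (R (e ω))‖ := by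
  obtain ⟨R, hR1, hR2, hR3⟩ := hf.start ω hG hω h0
  refine ⟨R, ?_, hR2, hR3⟩
  obtain ⟨m, hm⟩ := Nat.exists_eq_add_of_le' (hf.base.blockLeft_pos hG hω)
  rw [hm] at hR1 ⊢
  rw [cocycle_succ', hR1, hf.prod_succ]
  cases m with
  | zero => rw [hf.prod_zero]; rfl
  | succ m =>
    obtain ⟨h1, h2, h3⟩ := hf.base.blockLeft_succ hG hω hm
    rw [hf.cocycle_inside_block m ((hf.base.invariant ω).mpr hG) h1 (by omega) h3]
    rfl

theorem hasRatio_block (hf : IsBlockField θ N K V G ε M B Q S e) {ω : Ω}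
    (hG : ω ∈ G) (hω : ω ∉ tower θ N V) (h0 : exitAge θ N V ω % N = 0) :
    HasRatio θ S e ε M 1 0 (blockLeft θ N V ω) ω := by
  obtain ⟨R, hR1, hR2, hR3⟩ := hf.exists_cocycle_block_eq hG hω h0
  have hε := hf.eps_pos
  have hε' := hf.eps_lt
  unfold HasRatio
  rw [hR1, pow_one, pow_zero, div_one]
  calc ε * ‖(Q (blockLeft θ N V ω) ω).comp R‖
      ≤ ε * (‖Q (blockLeft θ N V ω) ω‖ * (3 / 2)) := by
        gcongr
        refine (ContinuousLinearMap.opNorm_comp_le _ _).trans ?_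
        gcongr
        linarith
    _ = 3 / 2 * ε * ‖Q (blockLeft θ N V ω) ω‖ := by ring
    _ ≤ _ := hR3

theorem le_growth_block (hf : IsBlockField θ N K V G ε M B Q S e) {ω : Ω}
    (hG : ω ∈ G) (hω : ω ∉ tower θ N V) (h0 : exitAge θ N V ω % N = 0) :
    ε ^ (N + 1) ≤ ‖cocycle θ S (blockLeft θ N V ω) ω (e ω)‖ := by
  obtain ⟨R, hR1, hR2, hR3⟩ := hf.exists_cocycle_block_eq hG hω h0
  have hε := hf.eps_pos
  have hε' := hf.eps_lt
  have h1 : ε ^ N ≤ ‖Q (blockLeft θ N V ω) ω‖ :=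
    (pow_le_pow_of_le_one hε.le (by linarith)
      ((min_le_left _ _).trans (Nat.sub_le _ _))).trans (hf.le_prod _ ω)
  rw [hR1]
  refine le_trans ?_ hR3
  rw [pow_succ, mul_comm]
  have h2 : ε * ε ^ N ≤ ε * ‖Q (blockLeft θ N V ω) ω‖ := by gcongr
  have h3 : 0 ≤ ε * ‖Q (blockLeft θ N V ω) ω‖ := by positivity
  linarith

/-- Step back to the start of the block, where the growth of the whole block is known; each step
back gains at most a factor `M`. -/
theorem le_growth_block_rest (hf : IsBlockField θ N K V G ε M B Q S e) (i : ℕ) {ω : Ω}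
    (hG : ω ∈ G) (hω : ω ∉ tower θ N V) (hi : exitAge θ N V ω % N = i) :
    ε ^ (N + 1) ≤ M ^ i * ‖cocycle θ S (blockLeft θ N V ω) ω (e ω)‖ := by
  induction i generalizing ω with
  | zero => simpa using hf.le_growth_block hG hω hi
  | succ i ih =>
    have hM := hf.one_le
    have hne : exitAge θ N V ω ≠ 0 := by
      rintro h
      rw [h, Nat.zero_mod] at hi
      omega
    have hω' := symm_notMem_tower hω hne
    have hG' : θ.symm ω ∈ G := hf.base.symm_mem.mpr hG
    have h1 := hf.base.exitAge_succ hG' hω'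
    have h2 := hf.base.hitTime_succ' hG' hω'
    rw [θ.apply_symm_apply] at h1 h2
    have hN := hf.base.pos
    have h3 : exitAge θ N V (θ.symm ω) % N = i := by
      have h4 : (exitAge θ N V (θ.symm ω) % N + 1) % N = i + 1 := by
        rw [Nat.mod_add_mod, ← h1, hi]
      have h5 := Nat.mod_lt (exitAge θ N V (θ.symm ω)) hN
      rcases Nat.lt_or_ge (exitAge θ N V (θ.symm ω) % N + 1) N with h6 | h6
      · rw [Nat.mod_eq_of_lt h6] at h4
        omega
      · rw [show exitAge θ N V (θ.symm ω) % N + 1 = N by omega, Nat.mod_self] at h4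
        omega
    have h7 : blockLeft θ N V (θ.symm ω) = 1 + blockLeft θ N V ω := by
      have := Nat.mod_lt (exitAge θ N V ω) hN
      unfold blockLeft
      omega
    have h8 := ih hG' hω' h3
    rw [h7, hf.norm_cocycle_add_apply hG', Function.iterate_one, θ.apply_symm_apply] at h8
    have h9 := hf.norm_cocycle_apply_le hG' 1
    rw [pow_one] at h9
    calc ε ^ (N + 1) ≤ _ := h8
      _ ≤ M ^ i * (M * ‖cocycle θ S (blockLeft θ N V ω) ω (e ω)‖) := by gcongr
      _ = _ := by rw [pow_succ]; ring

/-- The block is completed on both sides of the `j` given steps. At most `N - j` steps are added,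
each expanding by at most `M`. -/
theorem le_growth_partial_block (hf : IsBlockField θ N K V G ε M B Q S e) {ω : Ω}
    (hG : ω ∈ G) (hω : ω ∉ tower θ N V) {j : ℕ} (hj : j ≤ blockLeft θ N V ω) :
    ε ^ (N + 1) ≤ M ^ (N - j) * ‖cocycle θ S j ω (e ω)‖ := by
  have hM := hf.one_le
  have h1 := hf.le_growth_block_rest _ hG hω rfl
  rw [← Nat.add_sub_cancel' hj, hf.norm_cocycle_add_apply hG] at h1
  have h2 := hf.norm_cocycle_apply_le ((hf.base.iterate_mem (ω := ω) j).mpr hG)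
    (blockLeft θ N V ω - j)
  have h3 : exitAge θ N V ω % N + (blockLeft θ N V ω - j) ≤ N - j := by
    have := Nat.mod_lt (exitAge θ N V ω) hf.base.pos
    unfold blockLeft at hj ⊢
    omega
  calc ε ^ (N + 1) ≤ _ := h1
    _ ≤ M ^ (exitAge θ N V ω % N) *
          (‖cocycle θ S j ω (e ω)‖ * M ^ (blockLeft θ N V ω - j)) := by gcongr
    _ = M ^ (exitAge θ N V ω % N + (blockLeft θ N V ω - j)) * ‖cocycle θ S j ω (e ω)‖ := by
        rw [pow_add]; ring
    _ ≤ _ := by gcongr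

theorem hasRatio_partial_block (hf : IsBlockField θ N K V G ε M B Q S e) {ω : Ω}
    (hG : ω ∈ G) (hω : ω ∉ tower θ N V) {j : ℕ} (hj : j ≤ blockLeft θ N V ω) :
    HasRatio θ S e ε M (N + 1) N j ω :=
  hf.hasRatio_of_le hG (hj.trans ((min_le_left _ _).trans (Nat.sub_le _ _)))
    (hf.le_growth_partial_block hG hω hj)

theorem hasRatio_tower (hf : IsBlockField θ N K V G ε M B Q S e) {ω : Ω} (hG : ω ∈ G)
    (hω : ω ∈ tower θ N V) : HasRatio θ S e ε M 1 1 1 ω :=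
  hf.hasRatio_of_le hG le_rfl (by simpa [cocycle_one] using hf.growth ω hG hω)

/-- Only complete blocks occur, counting the shortened last one: at most `D / N + 1` of them, and no
power of `M` is lost. -/
theorem hasRatio_to_tower (hf : IsBlockField θ N K V G ε M B Q S e) (D : ℕ) {ω : Ω} (hG : ω ∈ G)
    (hω : IsStart θ N V ω) (hD : hitTime θ V ω = D) :
    HasRatio θ S e ε M (D / N + 1) 0 D ω := by
  induction D using Nat.strong_induction_on generalizing ω with
  | _ D ih =>
    rcases hω with hV | ⟨hω, h0⟩
    · rw [← hD, hitTime_eq_zero hV]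
      exact hf.hasRatio_zero _ _ ω
    · have hN := hf.base.pos
      have h1 := blockLeft_start (V := V) h0
      have h2 := hf.hasRatio_block hG hω h0
      rw [hD] at h1
      rcases le_or_gt D N with hle | hlt
      · rw [h1, min_eq_right hle] at h2
        exact hf.hasRatio_mono h2 (Nat.le_add_left _ _) le_rfl
      · have h3 := hf.base.isStart_after_block hG hω
        rw [h1, min_eq_left hlt.le] at h2 h3
        have h4 := (hf.base.gap_iterate hG hω N (by omega)).2.2
        have h5 := ih (D - N) (by omega) ((hf.base.iterate_mem (ω := ω) N).mpr hG) h3 (by omega)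
        have h6 := hf.hasRatio_add hG h2 h5
        rw [Nat.add_sub_cancel' hlt.le] at h6
        refine hf.hasRatio_mono h6 ?_ le_rfl
        rw [Nat.div_eq_sub_div hN hlt.le]
        omega

theorem hasRatio_before_tower (hf : IsBlockField θ N K V G ε M B Q S e) (n : ℕ) {ω : Ω}
    (hG : ω ∈ G) (hω : IsStart θ N V ω) (hn : n ≤ hitTime θ V ω) :
    HasRatio θ S e ε M (n / N + (N + 1)) N n ω := by
  induction n using Nat.strong_induction_on generalizing ω with
  | _ n ih =>
    rcases hω with hV | ⟨hω, h0⟩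
    · rw [hitTime_eq_zero hV, Nat.le_zero] at hn
      rw [hn]
      exact hf.hasRatio_zero _ _ ω
    · have hN := hf.base.pos
      have h1 := blockLeft_start (V := V) h0
      rcases le_or_gt n (blockLeft θ N V ω) with hle | hlt
      · exact hf.hasRatio_mono (hf.hasRatio_partial_block hG hω hle)
          (Nat.le_add_left _ _) le_rfl
      · have h2 := hf.hasRatio_block hG hω h0
        have h3 := hf.base.isStart_after_block hG hω
        have hmN : blockLeft θ N V ω = N := by omega
        rw [hmN] at h2 h3 hlt
        have h4 := (hf.base.gap_iterate hG hω N (by omega)).2.2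
        have h5 := ih (n - N) (by omega) ((hf.base.iterate_mem (ω := ω) N).mpr hG) h3 (by omega)
        have h6 := hf.hasRatio_add hG h2 h5
        rw [Nat.add_sub_cancel' hlt.le] at h6
        refine hf.hasRatio_mono h6 ?_ (by omega)
        rw [Nat.div_eq_sub_div hN hlt.le]
        omega

/-- The index `j` counts the steps left in the tower, each costing one `ε` and one `M`. Since `n ≤
K`, the next passage is not reached. -/
theorem hasRatio_from_tower (hf : IsBlockField θ N K V G ε M B Q S e) {τ : Ω} (hτ : τ ∈ V)
    (hG : τ ∈ G) (j : ℕ) (hj : j ≤ N) (n : ℕ) (hn : n ≤ K) :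
    HasRatio θ S e ε M (j + ((n - j) / N + (N + 1))) (j + N) n (θ^[N - j] τ) := by
  induction j generalizing n with
  | zero =>
    have h1 := hf.base.lt_hitTime_exit hτ hG
    have h2 := hf.hasRatio_before_tower n ((hf.base.iterate_mem (ω := τ) N).mpr hG)
      (Or.inr ⟨hf.base.exit_notMem_tower hτ, by rw [exitAge_exit hτ, Nat.zero_mod]⟩) (by omega)
    simpa using h2
  | succ j ih =>
    cases n with
    | zero => exact hf.hasRatio_zero _ _ _
    | succ n =>
      have h1 := hf.hasRatio_tower ((hf.base.iterate_mem (ω := τ) (N - (j + 1))).mpr hG)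
        (mem_tower.mpr ⟨N - (j + 1), by omega, τ, hτ, rfl⟩)
      have h2 := ih (by omega) n (by omega)
      have h3 : θ^[N - j] τ = θ^[1] (θ^[N - (j + 1)] τ) := by
        rw [← Function.iterate_add_apply]
        congr 2
        omega
      rw [h3] at h2
      have h4 := hf.hasRatio_add ((hf.base.iterate_mem (ω := τ) (N - (j + 1))).mpr hG) h1 h2
      rw [add_comm 1 n] at h4
      refine hf.hasRatio_mono h4 ?_ (by omega)
      rw [show n + 1 - (j + 1) = n - j by omega]
      omega

theorem hasRatio_window (hf : IsBlockField θ N K V G ε M B Q S e) {ω : Ω} (hG : ω ∈ G) {k : ℕ}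
    (hk : k * N ≤ K) : HasRatio θ S e ε M (k + 4 * N) (4 * N) (k * N) ω := by
  have hN := hf.base.pos
  by_cases hω : ω ∈ tower θ N V
  · obtain ⟨i, hi, τ, hτ, rfl⟩ := mem_tower.mp hω
    have h1 := hf.hasRatio_from_tower hτ ((hf.base.iterate_mem i).mp hG) (N - i) (by omega)
      (k * N) hk
    rw [show N - (N - i) = i by omega] at h1
    have h2 : (k * N - (N - i)) / N ≤ k :=
      Nat.div_le_of_le_mul (by rw [mul_comm N k]; exact Nat.sub_le _ _)
    exact hf.hasRatio_mono h1 (by omega) (by omega)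
  · set m := blockLeft θ N V ω with hm
    rcases le_or_gt (k * N) m with hle | hlt
    · exact hf.hasRatio_mono (hf.hasRatio_partial_block hG hω hle) (by omega) (by omega)
    · have hm1 : 1 ≤ m := hf.base.blockLeft_pos hG hω
      have h1 := hf.hasRatio_partial_block hG hω (le_refl m)
      have h2 := hf.base.isStart_after_block hG hω
      rw [← hm] at h2
      have hG' := (hf.base.iterate_mem (ω := ω) m).mpr hG
      set D := hitTime θ V (θ^[m] ω) with hD
      rcases le_or_gt (k * N - m) D with hle | hlt'
      · have h3 := hf.hasRatio_add hG h1 (hf.hasRatio_before_tower (k * N - m) hG' h2 hle)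
        rw [Nat.add_sub_cancel' hlt.le] at h3
        -- As `m ≥ 1`, the remaining steps hold fewer than `k` full blocks.
        have h4 : (k * N - m) / N < k := (Nat.div_lt_iff_lt_mul hN).mpr (by omega)
        exact hf.hasRatio_mono h3 (by omega) (by omega)
      · have hτ : θ^[D] (θ^[m] ω) ∈ V := hitTime_mem (hf.base.forward _ hG')
        have hGτ := (hf.base.iterate_mem (ω := θ^[m] ω) D).mpr hG'
        have h3 := hf.hasRatio_to_tower D hG' h2 rfl
        have h4 := hf.hasRatio_from_tower hτ hGτ N le_rfl (k * N - m - D) (by omega)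
        rw [Nat.sub_self, Function.iterate_zero_apply] at h4
        have h5 := hf.hasRatio_add hG h1 (hf.hasRatio_add hG' h3 h4)
        rw [show m + (D + (k * N - m - D)) = k * N by omega] at h5
        refine hf.hasRatio_mono h5 ?_ (by omega)
        have hx : D / N * N ≤ D := Nat.div_mul_le_self _ _
        have hy : (k * N - m - D - N) / N * N ≤ k * N - m - D - N := Nat.div_mul_le_self _ _
        rcases Nat.lt_or_ge (k * N - m - D) N with h6 | h6
        -- The window ends inside the tower. A number of steps strictly between `0` and `N` remains
        -- there, so `N ≥ 2`, which the exponent count needs.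
        · rw [Nat.sub_eq_zero_of_le h6.le, Nat.zero_div]
          have h7 : D / N < k := (Nat.div_lt_iff_lt_mul hN).mpr (by omega)
          omega
        -- The passage itself uses up `N` steps and the initial part at least one, so two full
        -- blocks are saved.
        · have h7 : D / N + (k * N - m - D - N) / N + 1 < k := by
            refine Nat.lt_of_mul_lt_mul_right (a := N) ?_
            rw [add_mul, add_mul, one_mul]
            omega
          omega

theorem le_growth (hf : IsBlockField θ N K V G ε M B Q S e) {ω : Ω} (hG : ω ∈ G) :
    ε ^ (N + 1) / M ^ (N - 1) ≤ ‖S ω (e ω)‖ := by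
  have hM := hf.one_le
  have hε := hf.eps_pos
  rw [div_le_iff₀' (by positivity)]
  by_cases hω : ω ∈ tower θ N V
  · have h1 : ε ^ (N + 1) ≤ ε ^ 1 :=
      pow_le_pow_of_le_one hε.le (by linarith [hf.eps_lt]) (by omega)
    calc ε ^ (N + 1) ≤ 1 * ε := by simpa using h1
      _ ≤ _ := mul_le_mul (one_le_pow₀ hM) (hf.growth ω hG hω) hε.le (by positivity)
  · simpa [cocycle_one] using
      hf.le_growth_partial_block hG hω (hf.base.blockLeft_pos hG hω)

end IsBlockField

end Growth

/-! ### The perturbed cocycle and its invariant direction. -/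

section Construction

set_option linter.unusedSectionVars false

variable {𝕜 H Ω : Type*} [RCLike 𝕜] [NormedAddCommGroup H] [InnerProductSpace 𝕜 H]

/-- The directions of the successive images of `h` under the maps `Φ(θ^i ω)`. -/
noncomputable def trail (𝕜 : Type*) {H Ω : Type*} [RCLike 𝕜] [NormedAddCommGroup H]
    [InnerProductSpace 𝕜 H] (θ : Ω → Ω) (Φ : Ω → H → H) (h : H) : ℕ → Ω → H
  | 0, _ => h
  | n + 1, ω => direction 𝕜 h (Φ (θ^[n] ω) (trail 𝕜 θ Φ h n ω))

theorem norm_trail {θ : Ω → Ω} {Φ : Ω → H → H} {h : H} (hh : ‖h‖ = 1) (n : ℕ) (ω : Ω) :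
    ‖trail 𝕜 θ Φ h n ω‖ = 1 := by
  cases n with
  | zero => exact hh
  | succ n => exact norm_direction hh _

/-- A field of operators along the gaps between the visits to a tower, depending on the incoming
direction `v`: inside the blocks it is a tilted field, at the starts of the blocks the incoming
direction is moved towards `u`. -/
noncomputable def gapField [MeasurableSpace Ω] (θ : Ω ≃ᵐ Ω) (N : ℕ) (V : Set Ω)
    (T : Ω → H →L[𝕜] H) (ε : ℝ) (h : H) (u : ℕ → Ω → H) (ω : Ω) (v : H) : H →L[𝕜] H :=
  open Classical in
  if exitAge θ N V ω % N = 0 then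
    (tilted θ T ε h (blockLeft θ N V ω - 1) ω).comp
      (kick ε (tiltedBlock θ T ε h (blockLeft θ N V ω) ω) (u (blockLeft θ N V ω) ω) v)
  else tilted θ T ε h (blockLeft θ N V ω - 1) ω

theorem isCompactOperator_gapField [MeasurableSpace Ω] {θ : Ω ≃ᵐ Ω} {N : ℕ} {V : Set Ω}
    {T : Ω → H →L[𝕜] H} (hT : ∀ ω, IsCompactOperator (T ω)) {ε : ℝ} {h : H} {u : ℕ → Ω → H}
    (ω : Ω) (v : H) : IsCompactOperator (gapField θ N V T ε h u ω v) := by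
  unfold gapField
  split_ifs
  · exact (isCompactOperator_tilted hT _ ω).comp_clm _
  · exact isCompactOperator_tilted hT _ ω

theorem norm_gapField_sub_le [MeasurableSpace Ω] {θ : Ω ≃ᵐ Ω} {N : ℕ} {V : Set Ω}
    {T : Ω → H →L[𝕜] H} {ε : ℝ} (hε : 0 < ε) (hε' : ε < 1 / 6) {h : H} (hh : ‖h‖ = 1)
    {u : ℕ → Ω → H} (hu : ∀ m ω, ‖u m ω‖ = 1) {t : ℝ} {ω : Ω} (ht : ‖T ω‖ ≤ t) {v : H}
    (hv : ‖v‖ = 1) : ‖gapField θ N V T ε h u ω v - T ω‖ ≤ 3 * ε * (1 + t) := by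
  have ht0 : 0 ≤ t := (norm_nonneg _).trans ht
  unfold gapField
  set B := tilted θ T ε h (blockLeft θ N V ω - 1) ω
  have h1 : ‖B - T ω‖ ≤ ε := norm_tilted_sub_le hε.le hh _ ω
  have h2 : ‖B‖ ≤ ε + t := by
    rw [← sub_add_cancel B (T ω)]
    exact (norm_add_le _ _).trans (add_le_add h1 ht)
  split_ifs
  · set R := kick ε (tiltedBlock θ T ε h (blockLeft θ N V ω) ω) (u (blockLeft θ N V ω) ω) v
    have h3 : ‖R - ContinuousLinearMap.id 𝕜 H‖ ≤ 2 * ε := norm_kick_sub_le hε.le _ (hu _ ω) hv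
    have h4 : B.comp R - T ω = (B - T ω) + B.comp (R - ContinuousLinearMap.id 𝕜 H) := by
      rw [ContinuousLinearMap.comp_sub, ContinuousLinearMap.comp_id]
      abel
    rw [h4]
    calc _ ≤ ε + (ε + t) * (2 * ε) := (norm_add_le _ _).trans (add_le_add h1
          ((ContinuousLinearMap.opNorm_comp_le _ _).trans (by gcongr)))
      -- `ε + 2ε(ε + t) = ε(1 + 2ε + 2t) ≤ 3ε(1 + t)`.
      _ ≤ _ := by nlinarith
  · refine h1.trans ?_
    nlinarith

variable [MeasurableSpace H] [BorelSpace H] [TopologicalSpace.SeparableSpace H]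
  [MeasurableSpace Ω]

/-- The sign in the kick jumps as the direction varies, so continuity of `Φ ω` is not available;
measurability is required along measurable arguments instead. -/
theorem measurable_trail {θ : Ω → Ω} (hθ : Measurable θ) {Φ : Ω → H → H} {h : H}
    (hΦ : ∀ (g : Ω → Ω) (f : Ω → H), Measurable g → Measurable f →
      Measurable fun ω => Φ (g ω) (f ω)) (n : ℕ) :
    Measurable (trail 𝕜 θ Φ h n) := by
  induction n with
  | zero => exact measurable_const
  | succ n ih => exact measurable_direction h (hΦ _ _ (hθ.iterate n) ih)

theorem measurable_exitAge (θ : Ω ≃ᵐ Ω) (N : ℕ) {V : Set Ω} (hV : MeasurableSet V) :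
    Measurable (exitAge θ N V) :=
  measurable_hitTime θ.symm.measurable (measurableSet_image_iterate θ N hV)

theorem measurable_blockLeft (θ : Ω ≃ᵐ Ω) (N : ℕ) {V : Set Ω} (hV : MeasurableSet V) :
    Measurable (blockLeft θ N V) :=
  ((measurable_from_top (f := fun n : ℕ => N - n % N)).comp (measurable_exitAge θ N hV)).min
    (measurable_hitTime θ.measurable hV)

theorem measurable_gapField {θ : Ω ≃ᵐ Ω} {N : ℕ} {V : Set Ω} (hV : MeasurableSet V)
    {T : Ω → H →L[𝕜] H} (hT : ∀ x, Measurable fun ω => T ω x) {ε : ℝ} {h : H} {u : ℕ → Ω → H}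
    (hu : ∀ m, Measurable (u m)) {g : Ω → Ω} (hg : Measurable g) {f : Ω → H} (hf : Measurable f)
    (x : H) : Measurable fun ω => gapField θ N V T ε h u (g ω) (f ω) x := by
  classical
  have hm := (measurable_blockLeft θ N hV).comp hg
  have hB : ∀ x, Measurable fun ω => tilted θ T ε h (blockLeft θ N V (g ω) - 1) (g ω) x :=
    fun x => measurable_index (F := fun n ω => tilted θ T ε h n ω x)
      (fun n => (measurable_tilted_and_tiltedBlock θ.measurable hT ε h n).1 x)
      ((measurable_from_top (f := fun n : ℕ => n - 1)).comp hm) hg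
  have hQ : ∀ x, Measurable fun ω => tiltedBlock θ T ε h (blockLeft θ N V (g ω)) (g ω) x :=
    fun x => measurable_index (F := fun n ω => tiltedBlock θ T ε h n ω x)
      (fun n => (measurable_tilted_and_tiltedBlock θ.measurable hT ε h n).2 x) hm hg
  have hum : Measurable fun ω => u (blockLeft θ N V (g ω)) (g ω) := measurable_index hu hm hg
  have hset : MeasurableSet {ω | exitAge θ N V (g ω) % N = 0} :=
    (((measurable_from_top (f := fun n : ℕ => n % N)).comp (measurable_exitAge θ N hV)).comp hg)
      (measurableSet_singleton 0)
  have heq : (fun ω => gapField θ N V T ε h u (g ω) (f ω) x) = fun ω =>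
      if exitAge θ N V (g ω) % N = 0 then tilted θ T ε h (blockLeft θ N V (g ω) - 1) (g ω)
        (kick ε (tiltedBlock θ T ε h (blockLeft θ N V (g ω)) (g ω))
          (u (blockLeft θ N V (g ω)) (g ω)) (f ω) x)
      else tilted θ T ε h (blockLeft θ N V (g ω) - 1) (g ω) x := by
    funext ω
    unfold gapField
    split_ifs <;> rfl
  rw [heq]
  exact Measurable.ite hset (measurable_apply hB (measurable_kick ε hQ hum hf x)) (hB x)

/-- The increment of `β` in its own direction that raises the modulus to `ε`. -/
noncomputable def boost {𝕜 : Type*} [RCLike 𝕜] (ε : ℝ) (β : 𝕜) : 𝕜 :=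
  ((max 0 (ε - ‖β‖) * ‖β‖⁻¹ : ℝ) : 𝕜) * β

theorem norm_boost {ε : ℝ} {β : 𝕜} (hβ : 0 < ‖β‖) : ‖boost ε β‖ = max 0 (ε - ‖β‖) := by
  rw [boost, norm_mul, RCLike.norm_ofReal, abs_of_nonneg (by positivity), mul_assoc,
    inv_mul_cancel₀ hβ.ne', mul_one]

theorem le_norm_add_boost {ε : ℝ} {β : 𝕜} (hβ : 0 < ‖β‖) : ε ≤ ‖β + boost ε β‖ := by
  have h1 : β + boost ε β = ((1 + max 0 (ε - ‖β‖) * ‖β‖⁻¹ : ℝ) : 𝕜) * β := by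
    rw [boost]; push_cast; ring
  rw [h1, norm_mul, RCLike.norm_ofReal, abs_of_nonneg (by positivity), add_mul, mul_assoc,
    inv_mul_cancel₀ hβ.ne', mul_one, one_mul]
  linarith [le_max_right 0 (ε - ‖β‖)]

theorem measurable_boost (ε : ℝ) {β : Ω → 𝕜} (hβ : Measurable β) :
    Measurable fun ω => boost ε (β ω) :=
  (RCLike.measurable_ofReal.comp
    ((measurable_const.max (measurable_const.sub hβ.norm)).mul hβ.norm.inv)).mul hβ

/-- The estimates are required at every point. Off the invariant set `G` the constant projection
onto `h` satisfies them trivially. -/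
theorem norm_cocycle_le_one {θ : Ω ≃ᵐ Ω} {G : Set Ω} (hG : ∀ ω, θ ω ∈ G ↔ ω ∈ G)
    {S : Ω → H →L[𝕜] H} {h : H} (hh : ‖h‖ = 1)
    (hS : ∀ ω ∉ G, S ω = InnerProductSpace.rankOne 𝕜 h h) (n : ℕ) {ω : Ω} (hω : ω ∉ G) :
    ‖cocycle θ S n ω‖ ≤ 1 ∧ cocycle θ S n ω h = h := by
  induction n generalizing ω with
  | zero => exact ⟨ContinuousLinearMap.norm_id_le, rfl⟩
  | succ n ih =>
    obtain ⟨h1, h2⟩ := ih (ω := θ ω) (by rwa [hG])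
    rw [cocycle_succ', hS ω hω]
    constructor
    · refine (ContinuousLinearMap.opNorm_comp_le _ _).trans ?_
      rw [InnerProductSpace.norm_rankOne, hh]
      linarith
    · rw [ContinuousLinearMap.comp_apply, InnerProductSpace.rankOne_apply,
        inner_self_eq_norm_sq_to_K, hh]
      simpa using h2

theorem hasGoodDirection_of_isConnectingTower (hH : ¬ FiniteDimensional 𝕜 H) {μ : Measure Ω}
    [IsProbabilityMeasure μ] (hμ : NonAtomic μ) {θ : Ω ≃ᵐ Ω} (hθ : Ergodic θ μ)
    {T : Ω → H →L[𝕜] H} (hT : IsBddRandomCompact μ T) {ε : ℝ} (hε : 0 < ε) (hε' : ε < 1 / 6)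
    {N : ℕ} (hN : 1 ≤ N) {V : Set Ω} {η : ℝ} (hη : 0 < η) (hηε : η ≤ 3 * ε)
    (hV : IsConnectingTower μ θ T η N V) (k : ℕ) : HasGoodDirection μ θ T ε N k := by
  classical
  obtain ⟨h, hh⟩ := exists_norm_eq_one hH
  set t := supNorm μ T
  have ht0 : 0 ≤ t := ENNReal.toReal_nonneg
  obtain ⟨V', hVV', hV'm, hV'0, hV'⟩ :=
    exists_subset_no_return hμ hθ hV.measurableSet hV.pos (k * N + N)
  obtain ⟨G, hGm, hGae, hGinv, hG⟩ :=
    exists_invariant_conull hθ hV'm hV'0 (ae_norm_le_supNorm hT)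
  have hbase : IsSpreadBase θ N (k * N) V' G :=
    ⟨hN, hGinv, fun ω hω => (hG ω hω).2.1, fun ω hω => (hG ω hω).2.2, hV'⟩
  choose u hum hu using fun m => exists_measurable_almost_maximizer hh
    (measurable_tilted_and_tiltedBlock θ.measurable hT.stronglyMeasurable ε h m).2
  set c := exitAge θ N V' with hc
  have hcm : Measurable c := measurable_exitAge θ N hV'm
  let F : Ω → H → H →L[𝕜] H := gapField θ N V' T ε h u
  let E : ℕ → Ω → H := trail 𝕜 θ (fun ω v => F ω v v) h
  have hFm : ∀ (g : Ω → Ω) (f : Ω → H), Measurable g → Measurable f →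
      ∀ x, Measurable fun ω => F (g ω) (f ω) x := fun g f hg hf x =>
    measurable_gapField hV'm hT.stronglyMeasurable hum hg hf x
  have hEm : ∀ n, Measurable (E n) := measurable_trail θ.measurable
    fun g f hg hf => measurable_apply (hFm g f hg hf) hf
  -- Go back to the last exit, where the direction is `h`, and follow the images for `c ω` steps.
  let e₀ : Ω → H := fun ω => E (c ω) (θ.symm^[c ω] ω)
  have he₀ : IsRandomUnit e₀ := by
    refine ⟨measurable_index hEm hcm ?_, fun ω => norm_trail hh _ _⟩
    exact measurable_index (F := fun n => θ.symm^[n]) (fun n => θ.symm.measurable.iterate n) hcm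
      measurable_id
  have he₀succ : ∀ ω ∈ G, ω ∉ tower θ N V' →
      F ω (e₀ ω) (e₀ ω) = ((‖F ω (e₀ ω) (e₀ ω)‖ : ℝ) : 𝕜) • e₀ (θ ω) := by
    intro ω hω hωW
    have h1 : e₀ (θ ω) = direction 𝕜 h (F ω (e₀ ω) (e₀ ω)) := by
      simp only [e₀]
      rw [hc, hbase.exitAge_succ hω hωW, Function.iterate_succ_apply, θ.symm_apply_apply]
      simp only [E]
      rw [trail, iterate_iterate_symm]
    rw [h1, norm_smul_direction]
  -- The connection is prescribed over all of `V`, but only its part over `V'` is used. There it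
  -- joins the arriving direction to `h`.
  obtain ⟨S₁, β, e₁, hS₁, hβm, he₁, hee, hβ, -, hS₁T, hS₁e⟩ := hV.connect e₀ he₀
  set W := tower θ N V' with hW
  have hWm : MeasurableSet W := measurableSet_tower θ N hV'm
  have hWV : ∀ ω ∈ W, ω ∈ ⋃ i ∈ Finset.range N, θ^[i] '' V := fun ω hω => by
    obtain ⟨i, hi, τ, hτ, hiτ⟩ := mem_tower.mp hω
    exact mem_tower.mpr ⟨i, hi, τ, hVV' hτ, hiτ⟩
  have hβ0 : ∀ ω ∈ W, 0 < ‖β ω‖ := fun ω hω => by linarith [hβ ω (hWV ω hω)]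
  let e : Ω → H := fun ω => if ω ∈ G then if ω ∈ W then e₁ ω else e₀ ω else h
  let S : Ω → H →L[𝕜] H := fun ω => if ω ∈ G then
    if ω ∈ W then S₁ ω + boost ε (β ω) • InnerProductSpace.rankOne 𝕜 (e₁ (θ ω)) (e₁ ω)
    else F ω (e₀ ω) else InnerProductSpace.rankOne 𝕜 h h
  have heW : ∀ ω ∈ G, ω ∈ W → e ω = e₁ ω := fun ω h1 h2 => by simp only [e, if_pos h1, if_pos h2]
  have heC : ∀ ω ∈ G, ω ∉ W → e ω = e₀ ω := fun ω h1 h2 => by simp only [e, if_pos h1, if_neg h2]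
  have heN : ∀ ω, ω ∉ G → e ω = h := fun ω h1 => by simp only [e, if_neg h1]
  have hSW : ∀ ω ∈ G, ω ∈ W → S ω = S₁ ω + boost ε (β ω) •
      InnerProductSpace.rankOne 𝕜 (e₁ (θ ω)) (e₁ ω) := fun ω h1 h2 => by
    simp only [S, if_pos h1, if_pos h2]
  have hSC : ∀ ω ∈ G, ω ∉ W → S ω = F ω (e₀ ω) := fun ω h1 h2 => by
    simp only [S, if_pos h1, if_neg h2]
  have hSN : ∀ ω, ω ∉ G → S ω = InnerProductSpace.rankOne 𝕜 h h := fun ω h1 => by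
    simp only [S, if_neg h1]
  have hrank : InnerProductSpace.rankOne 𝕜 h h h = h := by
    rw [InnerProductSpace.rankOne_apply, inner_self_eq_norm_sq_to_K, hh]; simp
  have heunit : IsRandomUnit e := by
    refine ⟨Measurable.ite hGm (Measurable.ite hWm he₁.measurable he₀.measurable)
      measurable_const, fun ω => ?_⟩
    simp only [e]
    split_ifs
    · exact he₁.norm_eq_one ω
    · exact he₀.norm_eq_one ω
    · exact hh
  have hSeW : ∀ ω ∈ G, ω ∈ W → S ω (e ω) = (β ω + boost ε (β ω)) • e (θ ω) := by
    intro ω hωG hωW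
    obtain ⟨i, hi, τ, hτ, rfl⟩ := mem_tower.mp hωW
    have h1 : e (θ (θ^[i] τ)) = e₁ (θ (θ^[i] τ)) := by
      by_cases h2 : θ (θ^[i] τ) ∈ W
      · exact heW _ ((hGinv _).mpr hωG) h2
      · rw [heC _ ((hGinv _).mpr hωG) h2, hee]
        right
        rw [← Function.iterate_succ_apply' θ] at h2 ⊢
        have h3 : N = i + 1 := by
          by_contra hne
          exact h2 (mem_tower.mpr ⟨i + 1, by omega, τ, hτ, rfl⟩)
        exact ⟨τ, hVV' hτ, by rw [h3]⟩
    rw [h1, heW _ hωG hωW, hSW _ hωG hωW, add_apply, hS₁e τ (hVV' hτ) i hi, smul_apply,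
      InnerProductSpace.rankOne_apply, inner_self_eq_norm_sq_to_K, he₁.norm_eq_one,
      Function.iterate_succ_apply' θ, add_smul]
    simp
  have hSeC : ∀ ω ∈ G, ω ∉ W → ∃ a : 𝕜, S ω (e ω) = a • e (θ ω) := by
    intro ω hωG hωW
    have h1 : e (θ ω) = e₀ (θ ω) := by
      by_cases h2 : θ ω ∈ W
      · rw [heW _ ((hGinv _).mpr hωG) h2, hee]
        exact Or.inl (hVV' (IsSpreadBase.mem_base_of_mem_tower hωW h2))
      · exact heC _ ((hGinv _).mpr hωG) h2
    exact ⟨_, by rw [h1, heC _ hωG hωW, hSC _ hωG hωW]; exact he₀succ ω hωG hωW⟩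
  have hinv : ∀ ω ∈ G, ∃ a : 𝕜, S ω (e ω) = a • e (θ ω) := fun ω hωG => by
    by_cases hωW : ω ∈ W
    · exact ⟨_, hSeW ω hωG hωW⟩
    · exact hSeC ω hωG hωW
  have hclose : ∀ ω ∈ G, ‖S ω - T ω‖ ≤ 3 * ε * (1 + t) := by
    intro ω hωG
    by_cases hωW : ω ∈ W
    · have h1 : S ω - T ω = (S₁ ω - T ω) + boost ε (β ω) •
          InnerProductSpace.rankOne 𝕜 (e₁ (θ ω)) (e₁ ω) := by
        rw [hSW ω hωG hωW]; abel
      have h2 : ‖boost ε (β ω) • InnerProductSpace.rankOne 𝕜 (e₁ (θ ω)) (e₁ ω)‖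
          = max 0 (ε - ‖β ω‖) := by
        rw [norm_smul, InnerProductSpace.norm_rankOne, he₁.norm_eq_one, he₁.norm_eq_one,
          norm_boost (hβ0 ω hωW), mul_one, mul_one]
      -- If the boost is active, `‖β‖ ≥ η / 3` bounds the sum by `ε + 2η / 3`, and `η ≤ 3ε`.
      have h3 : η + max 0 (ε - ‖β ω‖) ≤ 3 * ε := by
        have h4 := hβ ω (hWV ω hωW)
        rcases max_cases 0 (ε - ‖β ω‖) with ⟨h5, -⟩ | ⟨h5, -⟩ <;> rw [h5] <;> linarith
      calc ‖S ω - T ω‖ ≤ η + max 0 (ε - ‖β ω‖) := by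
            rw [h1, ← h2]
            exact (norm_add_le _ _).trans (by gcongr; exact hS₁T ω (hWV ω hωW))
        _ ≤ 3 * ε := h3
        _ ≤ _ := by nlinarith
    · rw [hSC ω hωG hωW]
      exact norm_gapField_sub_le hε hε' hh (fun m ω => (hu m ω).1) (hG ω hωG).1
        (he₀.norm_eq_one ω)
  have hfield : IsBlockField θ N (k * N) V' G ε (1 + 2 * t) (tilted θ T ε h)
      (tiltedBlock θ T ε h) S e := by
    refine ⟨hbase, hε, hε', by linarith, fun _ => rfl, tiltedBlock_succ θ T ε h,
      pow_le_norm_tiltedBlock hε.le hh, fun ω hωG => ?_, heunit.norm_eq_one, hinv, ?_, ?_, ?_⟩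
    -- The constant `M = 1 + 2t` comes from `3ε(1 + t) + t` with `3ε < 1 / 2`.
    · have h1 : ‖S ω‖ ≤ ‖S ω - T ω‖ + ‖T ω‖ := by
        simpa using norm_add_le (S ω - T ω) (T ω)
      have h2 := hclose ω hωG
      have h3 := (hG ω hωG).1
      nlinarith
    · intro ω hωG hωW
      rw [hSeW ω hωG hωW, norm_smul, heunit.norm_eq_one, mul_one]
      exact le_norm_add_boost (hβ0 ω hωW)
    · intro ω hωG hωW h0
      rw [hSC ω hωG hωW]
      exact if_neg h0
    · intro ω hωG hωW h0
      refine ⟨kick ε (tiltedBlock θ T ε h (blockLeft θ N V' ω) ω) (u (blockLeft θ N V' ω) ω)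
        (e ω), ?_, norm_kick_le hε.le _ (hu _ ω).1 (heunit.norm_eq_one ω), ?_⟩
      · rw [hSC ω hωG hωW, heC ω hωG hωW]
        exact if_pos h0
      -- The factor `3 / 2` is `2 * (3 / 4)`: the size of the kick times the quality of the
      -- near-maximizer.
      · refine le_trans ?_ (le_norm_apply_kick hε.le _ (heunit.norm_eq_one ω))
        have := mul_le_mul_of_nonneg_left (hu (blockLeft θ N V' ω) ω).2
          (by positivity : 0 ≤ 2 * ε)
        linarith
  have hratio : ∀ a b : ℕ, ε ^ a / (1 + 2 * t) ^ b ≤ 1 := fun a b => by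
    rw [div_le_one (by positivity)]
    exact (pow_le_one₀ hε.le (by linarith)).trans (one_le_pow₀ (by linarith))
  have hcl : ∀ᵐ ω ∂μ, ‖S ω - T ω‖ ≤ 3 * ε * (1 + t) := hGae.mono hclose
  refine ⟨S, e, hT.of_norm_sub_le (fun ω => ?_) (fun x => ?_) hcl, heunit, fun ω => ?_,
    supNorm_le (by positivity) hcl, fun ω => ?_, fun ω => ?_⟩
  · simp only [S]
    split_ifs
    · exact (hS₁.compact ω).add ((isCompactOperator_rankOne _ _).smul _)
    · exact isCompactOperator_gapField hT.compact ω _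
    · exact isCompactOperator_rankOne h h
  · have h1 := measurable_add_smul_rankOne hS₁.stronglyMeasurable (measurable_boost ε hβm)
      (he₁.measurable.comp θ.measurable) he₁.measurable x
    have h2 := hFm id e₀ measurable_id he₀.measurable x
    have heq : (fun ω => S ω x) = fun ω => if ω ∈ G then
        if ω ∈ W then (S₁ ω + boost ε (β ω) •
          InnerProductSpace.rankOne 𝕜 (e₁ (θ ω)) (e₁ ω)) x
        else F ω (e₀ ω) x else InnerProductSpace.rankOne 𝕜 h h x := by
      funext ω
      simp only [S]
      split_ifs <;> rfl
    rw [heq]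
    exact Measurable.ite hGm (Measurable.ite hWm h1 h2) measurable_const
  · by_cases hωG : ω ∈ G
    · exact hinv ω hωG
    · refine ⟨1, ?_⟩
      rw [hSN ω hωG, heN ω hωG, heN (θ ω) (by rwa [hGinv]), hrank, one_smul]
  · by_cases hωG : ω ∈ G
    · exact hfield.le_growth hωG
    · rw [hSN ω hωG, heN ω hωG, hrank, hh]
      exact hratio _ _
  · by_cases hωG : ω ∈ G
    · exact hfield.hasRatio_window hωG le_rfl
    · obtain ⟨h1, h2⟩ := norm_cocycle_le_one hGinv hh hSN (k * N) hωG
      rw [heN ω hωG, h2, hh]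
      exact mul_le_one₀ (hratio _ _) (norm_nonneg _) h1

end Construction

end RandomCompact

theorem mainTheorem6 {𝕜 H Ω : Type*} [RCLike 𝕜]
    [NormedAddCommGroup H] [InnerProductSpace 𝕜 H] [CompleteSpace H]
    [TopologicalSpace.SeparableSpace H] [MeasurableSpace H] [BorelSpace H]
    (hH : ¬ FiniteDimensional 𝕜 H)
    [MeasurableSpace Ω] (μ : MeasureTheory.Measure Ω) [MeasureTheory.IsProbabilityMeasure μ]
    (hμ : RandomCompact.NonAtomic μ)
    (θ : Ω ≃ᵐ Ω) (hθ : Ergodic θ μ)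
    (T : Ω → H →L[𝕜] H) (hT : RandomCompact.IsNull μ θ T)
    (ε : ℝ) (hε : 0 < ε) (hε' : ε < 1 / 6) :
    (∀ (N : ℕ) (V : Set Ω) (η : ℝ), 1 ≤ N → 0 < η → η ≤ 3 * ε →
      RandomCompact.IsConnectingTower μ θ T η N V →
        ∀ k : ℕ, RandomCompact.HasGoodDirection μ θ T ε N k) ∧
    ∃ Nstar : ℕ, 1 ≤ Nstar ∧
      ∀ N : ℕ, Nstar ≤ N → ∀ k : ℕ, RandomCompact.HasGoodDirection μ θ T ε N k := by
  refine ⟨fun N V η hN hη hηε hV k =>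
    RandomCompact.hasGoodDirection_of_isConnectingTower hH hμ hθ hT.mem hε hε' hN hη hηε hV k, ?_⟩
  obtain ⟨Nstar, h1, h2⟩ := RandomCompact.exists_isConnectingTower hH hμ hθ hT hε
  refine ⟨Nstar, h1, fun N hN k => ?_⟩
  obtain ⟨V, hV⟩ := h2 N hN
  exact RandomCompact.hasGoodDirection_of_isConnectingTower hH hμ hθ hT.mem hε hε' (h1.trans hN)
    (by positivity) le_rfl hV k
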